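/- Let $H_0u(x)=-\sum_{|x-y|=1}(u(y)-u(x))$ be the negative discrete Laplacian on $\mathcal H=l^2(\mathbb Z^d)$, where $|\cdot|$ is the Euclidean norm. For a bounded real function $V$ on $\mathbb Z^d$ consider the uniform bound $$\sup_{z\in\mathbb C\setminus\mathbb R}\big\||V|^{1/2}(H_0-z)^{-1}|V|^{1/2}\big\|_{B(\mathcal H)}<\infty.\qquad(\mathrm{BS})$$ For $0<p<\infty$, $l^{p,\infty}(\mathbb Z^d)$ is the set of functions $f$ with $\sup_{\alpha>0}\alpha\,\#\{x:|f(x)|>\alpha\}^{1/p}<\infty$, and $l^{\infty,\infty}=l^\infty$. With $\mathcal F_du(\xi)=\sum_{x\in\mathbb Z^d}e^{-2\pi i x\cdot\xi}u(x)$, $\xi\in\mathbb T^d=\mathbb R^d/\mathbb Z^d$, put $\chi(D)=\mathcal F_d^{-1}\chi\mathcal F_d$. (i) Let $d=1$ or $d=2$, and let $V\in l^\infty(\mathbb Z^d)$ be real-valued, $V\le 0$, not identically zero, with $V(x)\to0$ as $|x|\to\infty$. Then (BS) does not hold. Moreover, $H_0+\lambda V$ has at least one eigenvalue for every $\lambda>0$.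 (ii) Let $d=2$, and let $\chi\in C^\infty(\mathbb T^2)$ be non-negative and equal to $1$ in a neighbourhood of the four points $\{\xi:\xi_1,\xi_2\in\{1/4,3/4\}\}$ (in particular, $\chi$ may be supported in any prescribed neighbourhood of these points). Then there exists a real-valued $w\in l^{2,\infty}(\mathbb Z^2)$ such that $$\sup_{z\in\mathbb C\setminus\mathbb R}\|w\,\chi(D)(H_0-z)^{-1}w\|_{B(\mathcal H)}=\infty.$$ Moreover, for all $1\le p\le\infty$ and $1\le q<\infty$, the operators $\chi(D)(H_0-z)^{-1}$, $z\in\mathbb C\setminus\mathbb R$, are not uniformly bounded from $l^p(\mathbb Z^2)$ to $l^q(\mathbb Z^2)$: there is no constant $C$ such that $\|\chi(D)(H_0-z)^{-1}u\|_{l^q}\le C\|u\|_{l^p}$ for all $z\in\mathbb C\setminus\mathbb R$ and all $u\in l^2(\mathbb Z^2)\cap l^p(\mathbb Z^2)$. (iii) Let $d\ge3$ and $(d+2)/3<q\le\infty$. Then there exists a real-valued $V\in l^{q,\infty}(\mathbb Z^d)$ for which (BS) does not hold. In particular, if $d\ge5$, then there exists a real-valued $V\in l^{d/2,\infty}(\mathbb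 Z^d)$ for which (BS) does not hold. (iv) Let $d\ge3$, $0\le\alpha<2$ and $V(x)=(1+|x|)^{-\alpha}$. Then (BS) does not hold. -/

import Mathlib

noncomputable section

open scoped ENNReal

/-- The Hilbert space `ℓ²(ℤᵈ)` of complex square-summable functions. -/
abbrev l2Lattice (d : ℕ) : Type := lp (fun _ : Fin d → ℤ => ℂ) 2

/-- Translation of functions on `ℤᵈ`, `(τ_v u)(x) = u (x + v)`, on `ℓ²(ℤᵈ)`. -/
def latticeShift (d : ℕ) (v : Fin d → ℤ) : l2Lattice d →L[ℂ] l2Lattice d :=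
  LinearMap.mkContinuous
    { toFun := fun u => ⟨fun x => u (x + v), by
        have h2 : 0 < (2 : ℝ≥0∞).toReal := by norm_num
        exact (memℓp_gen_iff h2).2
          (((memℓp_gen_iff h2).1 (lp.memℓp u)).comp_injective (add_left_injective v))⟩
      map_add' := fun _ _ => rfl
      map_smul' := fun _ _ => rfl }
    1
    (fun u => by
      have h2 : 0 < (2 : ℝ≥0∞).toReal := by norm_num
      rw [one_mul, lp.norm_eq_tsum_rpow h2, lp.norm_eq_tsum_rpow h2]
      refine le_of_eq (congrArg (fun t : ℝ => t ^ (1 / (2 : ℝ≥0∞).toReal)) ?_)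
      exact (Equiv.addRight v).tsum_eq (fun x => ‖u x‖ ^ (2 : ℝ≥0∞).toReal))

theorem latticeShift_apply (d : ℕ) (v : Fin d → ℤ) (u : l2Lattice d) (x : Fin d → ℤ) :
    latticeShift d v u x = u (x + v) := rfl

/-- The negative discrete Laplacian `H₀ u (x) = -∑_{|x-y|=1} (u y - u x)` on `ℓ²(ℤᵈ)`.  The points
`y ∈ ℤᵈ` at Euclidean distance one from `x` are `x + e_j` and `x - e_j`, `j = 1, …, d`. -/
def negLaplacian (d : ℕ) : l2Lattice d →L[ℂ] l2Lattice d :=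
  -∑ j : Fin d, ((latticeShift d (Pi.single j 1) - ContinuousLinearMap.id ℂ (l2Lattice d)) +
    (latticeShift d (-Pi.single j 1) - ContinuousLinearMap.id ℂ (l2Lattice d)))

theorem negLaplacian_apply (d : ℕ) (u : l2Lattice d) (x : Fin d → ℤ) :
    negLaplacian d u x =
      -∑ j : Fin d, ((u (x + Pi.single j 1) - u x) + (u (x - Pi.single j 1) - u x)) := by
  have key : ∀ s : Finset (Fin d), (∑ j ∈ s,
      ((latticeShift d (Pi.single j 1) - ContinuousLinearMap.id ℂ (l2Lattice d)) +
      (latticeShift d (-Pi.single j 1) - ContinuousLinearMap.id ℂ (l2Lattice d)))) u x =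
      ∑ j ∈ s, ((u (x + Pi.single j 1) - u x) + (u (x - Pi.single j 1) - u x)) := by
    intro s
    rw [_root_.sum_apply, lp.coeFn_sum, Finset.sum_apply]
    rfl
  exact congrArg Neg.neg (key Finset.univ)

theorem adjoint_latticeShift (d : ℕ) (v : Fin d → ℤ) :
    ContinuousLinearMap.adjoint (latticeShift d v) = latticeShift d (-v) := by
  symm
  rw [ContinuousLinearMap.eq_adjoint_iff]
  intro u w
  rw [lp.inner_eq_tsum, lp.inner_eq_tsum]
  rw [← (Equiv.addRight v).tsum_eq]
  refine tsum_congr fun x => ?_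
  simp [latticeShift_apply]

theorem isSelfAdjoint_negLaplacian (d : ℕ) : IsSelfAdjoint (negLaplacian d) := by
  rw [ContinuousLinearMap.isSelfAdjoint_iff']
  simp only [negLaplacian, map_neg, map_sum, map_add, map_sub, adjoint_latticeShift, neg_neg]
  refine congrArg Neg.neg (Finset.sum_congr rfl fun j _ => ?_)
  have : ContinuousLinearMap.adjoint (ContinuousLinearMap.id ℂ (l2Lattice d)) =
    ContinuousLinearMap.id ℂ (l2Lattice d) := ContinuousLinearMap.adjoint_id
  rw [this]
  abel

theorem isUnit_negLaplacian_sub (d : ℕ) (z : ℂ) (hz : z.im ≠ 0) :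
    IsUnit (negLaplacian d - z • (1 : l2Lattice d →L[ℂ] l2Lattice d)) := by
  by_contra h
  have h1 : z ∈ spectrum ℂ (negLaplacian d) := by
    rw [spectrum.mem_iff, IsUnit.sub_iff, Algebra.algebraMap_eq_smul_one]
    exact h
  exact hz (by rw [(isSelfAdjoint_negLaplacian d).mem_spectrum_eq_re h1]; simp)

/-- The resolvent `(H₀ - z)⁻¹` as a bounded operator on `ℓ²(ℤᵈ)`.  As `H₀` is bounded and
self-adjoint, `H₀ - z` is invertible whenever `z` is not real
(`isUnit_negLaplacian_sub` above). -/
def freeResolvent (d : ℕ) (z : ℂ) : l2Lattice d →L[ℂ] l2Lattice d :=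
  Ring.inverse (negLaplacian d - z • (1 : l2Lattice d →L[ℂ] l2Lattice d))

open Classical in
/-- Multiplication by a bounded function on `ℓ²(ℤᵈ)`, `(f u)(x) = f(x) u(x)`
(the zero operator if `f` is unbounded). -/
def latticeMul (d : ℕ) (f : (Fin d → ℤ) → ℂ) : l2Lattice d →L[ℂ] l2Lattice d :=
  if h : Memℓp f ∞ then
    lp.mapCLM 2 (fun x => ContinuousLinearMap.mul ℂ ℂ (f x)) (K := ⨆ x, ‖f x‖)
      (Real.iSup_nonneg fun _ => norm_nonneg _)
      (fun x => by
        simpa using le_ciSup (memℓp_infty_iff.1 h) x)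
  else 0

theorem latticeMul_apply (d : ℕ) (f : (Fin d → ℤ) → ℂ) (hf : Memℓp f ∞) (u : l2Lattice d)
    (x : Fin d → ℤ) : latticeMul d f u x = f x * u x := by
  simp [latticeMul, hf]

/-- The uniform bound `sup_{z ∈ ℂ ∖ ℝ} ‖|V|^{1/2} (H₀ - z)⁻¹ |V|^{1/2}‖ < ∞` of the
Birman-Schwinger operators of a (bounded) real potential `V` on `ℤᵈ`. -/
def BirmanSchwingerBound (d : ℕ) (V : (Fin d → ℤ) → ℝ) : Prop :=
  BddAbove (Set.range fun z : {z : ℂ // z.im ≠ 0} =>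
    ‖latticeMul d (fun x => (Real.sqrt |V x| : ℂ)) ∘L freeResolvent d z ∘L
      latticeMul d (fun x => (Real.sqrt |V x| : ℂ))‖)

/-- The weak quasi-norm of `f : ℤᵈ → ℝ`: for `p < ∞` it is
`sup_{α > 0} α · #{x : |f x| > α}^{1/p}`, and for `p = ∞` it is the supremum norm. -/
def weakNorm (d : ℕ) (p : ℝ≥0∞) (f : (Fin d → ℤ) → ℝ) : ℝ≥0∞ :=
  if p = ∞ then ⨆ x, ENNReal.ofReal |f x|
  else ⨆ α : {α : ℝ // 0 < α},
    ENNReal.ofReal α * (Set.encard {x | (α : ℝ) < |f x|} : ℝ≥0∞) ^ (1 / p.toReal)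

/-- Membership of a real function in the weak (Lorentz) space `l^{p,∞}(ℤᵈ)`. -/
def MemWeak (d : ℕ) (p : ℝ≥0∞) (f : (Fin d → ℤ) → ℝ) : Prop := weakNorm d p f < ∞

/-- The Lebesgue (normalised Haar) measure on the torus `𝕋ᵈ = ℝᵈ/ℤᵈ`. -/
abbrev torusMeasure (d : ℕ) : MeasureTheory.Measure (UnitAddTorus (Fin d)) :=
  MeasureTheory.Measure.pi fun _ => AddCircle.haarAddCircle

/-- The monomials `e^{2πi x·ξ}`, `x ∈ ℤᵈ`, as a Hilbert basis of `L²(𝕋ᵈ)`. -/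
def torusBasis (d : ℕ) :
    HilbertBasis (Fin d → ℤ) ℂ (MeasureTheory.Lp ℂ 2 (torusMeasure d)) :=
  UnitAddTorus.mFourierBasis

/-- The reflection `u ↦ u(-x)` on `ℓ²(ℤᵈ)`. -/
def latticeReflect (d : ℕ) : l2Lattice d →L[ℂ] l2Lattice d :=
  LinearMap.mkContinuous
    { toFun := fun u => ⟨fun x => u (-x), by
        have h2 : 0 < (2 : ℝ≥0∞).toReal := by norm_num
        exact (memℓp_gen_iff h2).2
          (((memℓp_gen_iff h2).1 (lp.memℓp u)).comp_injective neg_injective)⟩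
      map_add' := fun _ _ => rfl
      map_smul' := fun _ _ => rfl }
    1
    (fun u => by
      have h2 : 0 < (2 : ℝ≥0∞).toReal := by norm_num
      rw [one_mul, lp.norm_eq_tsum_rpow h2, lp.norm_eq_tsum_rpow h2]
      refine le_of_eq (congrArg (fun t : ℝ => t ^ (1 / (2 : ℝ≥0∞).toReal)) ?_)
      exact (Equiv.neg (Fin d → ℤ)).tsum_eq (fun x => ‖u x‖ ^ (2 : ℝ≥0∞).toReal))

/-- The Fourier expansion `û(ξ) = ∑_{x ∈ ℤᵈ} e^{-2πi x·ξ} u(x)`, from `ℓ²(ℤᵈ)` to `L²(𝕋ᵈ)`. -/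
def latticeFourier (d : ℕ) : l2Lattice d →L[ℂ] MeasureTheory.Lp ℂ 2 (torusMeasure d) :=
  ((torusBasis d).repr.symm.toContinuousLinearEquiv : l2Lattice d →L[ℂ] _) ∘L latticeReflect d

/-- The inverse Fourier expansion: `g ↦ (x ↦ ∫_{𝕋ᵈ} e^{2πi x·ξ} g(ξ) dξ)`. -/
def latticeFourierInv (d : ℕ) : MeasureTheory.Lp ℂ 2 (torusMeasure d) →L[ℂ] l2Lattice d :=
  latticeReflect d ∘L ((torusBasis d).repr.toContinuousLinearEquiv : _ →L[ℂ] l2Lattice d)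

theorem latticeFourier_single (d : ℕ) (x : Fin d → ℤ) :
    latticeFourier d (lp.single 2 x 1) = UnitAddTorus.mFourierLp 2 (-x) := by
  have h : latticeReflect d (lp.single 2 x 1) = lp.single 2 (-x) 1 := by
    ext y
    change (lp.single 2 x (1:ℂ) : l2Lattice d) (-y) = (lp.single 2 (-x) (1:ℂ) : l2Lattice d) y
    by_cases hy : y = -x
    · subst hy; simp
    · rw [lp.single_apply_ne _ _ _ hy, lp.single_apply_ne]
      intro h; apply hy; rw [← h, neg_neg]
  change (torusBasis d).repr.symm (latticeReflect d (lp.single 2 x 1)) = _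
  rw [h, HilbertBasis.repr_symm_single]
  change UnitAddTorus.mFourierBasis (-x) = _
  rw [UnitAddTorus.coe_mFourierBasis]

theorem latticeFourierInv_apply (d : ℕ) (g : MeasureTheory.Lp ℂ 2 (torusMeasure d)) (x : Fin d → ℤ) :
    latticeFourierInv d g x = ∫ ξ, UnitAddTorus.mFourier x ξ * g ξ ∂(torusMeasure d) := by
  have := UnitAddTorus.mFourierBasis_repr g (-x)
  rw [UnitAddTorus.mFourierCoeff] at this
  simp only [neg_neg, smul_eq_mul] at this
  exact this

/-- Multiplication by a continuous function `χ` on `L²(𝕋ᵈ)`. -/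
def torusMul (d : ℕ) (χ : C(UnitAddTorus (Fin d), ℂ)) :
    MeasureTheory.Lp ℂ 2 (torusMeasure d) →L[ℂ] MeasureTheory.Lp ℂ 2 (torusMeasure d) :=
  (ContinuousLinearMap.mul ℂ ℂ).holderL (torusMeasure d) ∞ 2 2
    (ContinuousMap.toLp ∞ (torusMeasure d) ℂ χ)

theorem torusMul_ae (d : ℕ) (χ : C(UnitAddTorus (Fin d), ℂ)) (g : MeasureTheory.Lp ℂ 2 (torusMeasure d)) :
    torusMul d χ g =ᵐ[torusMeasure d] fun ξ => χ ξ * g ξ := by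
  have h1 := (ContinuousLinearMap.mul ℂ ℂ).coeFn_holder (r := 2) (ContinuousMap.toLp ∞ (torusMeasure d) ℂ χ) g
  have h2 := ContinuousMap.coeFn_toLp (p := ∞) (𝕜 := ℂ) (torusMeasure d) χ
  filter_upwards [h1, h2] with ξ a b
  rw [← b]; exact a

/-- The Fourier multiplier `χ(D) = 𝓕⁻¹ χ 𝓕` on `ℓ²(ℤᵈ)`. -/
def fourierMultiplier (d : ℕ) (χ : C(UnitAddTorus (Fin d), ℂ)) :
    l2Lattice d →L[ℂ] l2Lattice d :=
  latticeFourierInv d ∘L torusMul d χ ∘L latticeFourier d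

/-- A real continuous function on the torus, viewed as a complex one. -/
def complexSymbol (d : ℕ) (χ : C(UnitAddTorus (Fin d), ℝ)) : C(UnitAddTorus (Fin d), ℂ) :=
  (⟨Complex.ofReal, Complex.continuous_ofReal⟩ : C(ℝ, ℂ)).comp χ

/-- Smoothness of a function on `𝕋ᵈ = ℝᵈ/ℤᵈ`: its `ℤᵈ`-periodic lift to `ℝᵈ` is `C^∞`. -/
def TorusSmooth (d : ℕ) (χ : C(UnitAddTorus (Fin d), ℝ)) : Prop :=
  ContDiff ℝ ((⊤ : ℕ∞) : WithTop ℕ∞)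
    (fun t : Fin d → ℝ => χ (fun j => ((t j : ℝ) : UnitAddCircle)))

/-- The set of the points `ξ ∈ 𝕋ᵈ` all of whose coordinates are `1/4` or `3/4` modulo `1`. -/
def quarterPoints (d : ℕ) : Set (UnitAddTorus (Fin d)) :=
  {ξ | ∀ j, ξ j = ((1 / 4 : ℝ) : UnitAddCircle) ∨ ξ j = ((3 / 4 : ℝ) : UnitAddCircle)}

/-- The operators `T z`, `z ∈ ℂ ∖ ℝ`, on `ℓ²(ℤᵈ)` are uniformly bounded from `l^p(ℤᵈ)` to
`l^q(ℤᵈ)`: one constant `C` serves in `‖T z u‖_{l^q} ≤ C ‖u‖_{l^p}` for all `z ∈ ℂ ∖ ℝ` and all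
`u ∈ l²(ℤᵈ) ∩ l^p(ℤᵈ)` (in particular `T z u ∈ l^q(ℤᵈ)`).  Every family of extensions in
`B(l^p, l^q)` with uniformly bounded norms gives this estimate. -/
def UniformlyBoundedLp (d : ℕ) (p q : ℝ≥0∞) (T : ℂ → l2Lattice d →L[ℂ] l2Lattice d) : Prop :=
  ∃ C : ℝ, ∀ z : ℂ, z.im ≠ 0 → ∀ (u : l2Lattice d) (hu : Memℓp (fun x => u x) p),
    ∃ hv : Memℓp (fun x => T z u x) q,
      ‖(⟨fun x => T z u x, hv⟩ : lp (fun _ : Fin d → ℤ => ℂ) q)‖ ≤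
        C * ‖(⟨fun x => u x, hu⟩ : lp (fun _ : Fin d → ℤ => ℂ) p)‖

end

noncomputable section

open scoped ENNReal
open MeasureTheory

/-! On the Fourier side `H₀` is multiplication by `h(ξ) = ∑ⱼ (2 - 2 cos 2πξⱼ)`. For `z = E + iε` the
imaginary part of `⟨f, χ(D)(H₀ - z)⁻¹ f⟩` is the integral of `χ · ε / ((h - E)² + ε²) · |f̂|²`. The
integrand is non-negative, so it may be bounded below on any set of frequencies. Let `f` have
amplitudes `a ≥ 0` on a finite set `T`, modulated to a frequency `ξ₀`, and let `S` be a set of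
displacements `η` with `x·η` within `1/6` of an integer for `x ∈ T`. Then `|f̂| ≥ (∑ a)/2` on `ξ₀ +
S`. If also `|h - E| ≤ ε` and `χ = 1` there, the form is at least `|S| (∑ a)² / (8ε)`
(`exists_le_norm_inner_resolvent`). With `a = 1` and `|V| ≥ A` on `T`, (BS) forces `A |T| |S| ≤ C ε`
(`BirmanSchwingerBound.box_bound`). Parts (ii)-(iv) are choices of dual pairs `T`, `S`.

(iv) At the bottom of the spectrum `h` is quadratic: a cube of side `N` and a frequency box of side
`1/N` give `N^{-α} ≲ N^{-2}`.

(iii) At `(1/4, …, 1/4)` one has `h - 2d = 2 ∑ sin 2πηⱼ = 4π ∑ ηⱼ + O(|η|³)`, so the level set is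
flat up to third order. A Knapp slab of thickness `N^{-3}` and width `N^{-1}` is dual to a tube of
length `N³` along the diagonal and width `N`. This forces `N^{-β} ≲ N^{-3}` for a potential of size
`N^{-β}` on the tube. The tube has about `N^{d+2}` points, so such a potential lies in weak `l^q`
with `q = (d+2)/β`.

(ii) For `d = 2` the level set `h = 4` contains segments of `η₀ + η₁ = 0`, so the slab keeps a fixed
width. Its dual is the set of diagonal points, and the form is at least `c (∑ a)²`. Amplitudes `1/m`
defeat the weight `m^{-1/2}`, since the harmonic series diverges; amplitudes `1` defeat every `l^p →
l^q` bound with `q < ∞`.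

(i) In dimensions one and two `∫ (h + ε)⁻¹` diverges as `ε → 0`
(`exists_integral_inv_laplaceSymbol_ge`). Testing on one point mass refutes (BS). The trial vector
`(H₀ + ε)⁻¹ δ` makes the form of `H₀ + λV` negative, and compactness of `V` turns the resulting
negative spectrum into an eigenvalue. -/

/-! ### Fourier transform and Fourier multipliers on the lattice -/

theorem latticeReflect_reflect (d : ℕ) (u : l2Lattice d) :
    latticeReflect d (latticeReflect d u) = u := by
  ext x
  change u (- -x) = u x
  rw [neg_neg]

theorem inner_latticeReflect (d : ℕ) (u v : l2Lattice d) :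
    inner ℂ (latticeReflect d u) (latticeReflect d v) = inner ℂ u v := by
  rw [lp.inner_eq_tsum, lp.inner_eq_tsum]
  exact (Equiv.neg (Fin d → ℤ)).tsum_eq (fun x => inner ℂ (u x) (v x))

theorem latticeFourierInv_fourier (d : ℕ) (u : l2Lattice d) :
    latticeFourierInv d (latticeFourier d u) = u := by
  change latticeReflect d ((torusBasis d).repr ((torusBasis d).repr.symm (latticeReflect d u))) = u
  rw [LinearIsometryEquiv.apply_symm_apply, latticeReflect_reflect]

theorem latticeFourier_fourierInv (d : ℕ) (g : Lp ℂ 2 (torusMeasure d)) :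
    latticeFourier d (latticeFourierInv d g) = g := by
  change (torusBasis d).repr.symm (latticeReflect d (latticeReflect d ((torusBasis d).repr g))) = g
  rw [latticeReflect_reflect, LinearIsometryEquiv.symm_apply_apply]

theorem inner_latticeFourier (d : ℕ) (u v : l2Lattice d) :
    inner ℂ (latticeFourier d u) (latticeFourier d v) = inner ℂ u v := by
  change inner ℂ ((torusBasis d).repr.symm (latticeReflect d u))
    ((torusBasis d).repr.symm (latticeReflect d v)) = _
  rw [LinearIsometryEquiv.inner_map_map, inner_latticeReflect]

theorem torusMul_mul (d : ℕ) (f g : C(UnitAddTorus (Fin d), ℂ)) :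
    torusMul d (f * g) = torusMul d f ∘L torusMul d g := by
  ext1 u
  apply Lp.ext
  filter_upwards [torusMul_ae d (f * g) u, torusMul_ae d f (torusMul d g u), torusMul_ae d g u]
    with ξ h1 h2 h3
  rw [h1, ContinuousLinearMap.comp_apply, h2, h3, ContinuousMap.mul_apply, mul_assoc]

theorem torusMul_add (d : ℕ) (f g : C(UnitAddTorus (Fin d), ℂ)) :
    torusMul d (f + g) = torusMul d f + torusMul d g := by
  simp [torusMul]

theorem torusMul_smul (d : ℕ) (c : ℂ) (g : C(UnitAddTorus (Fin d), ℂ)) :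
    torusMul d (c • g) = c • torusMul d g := by
  simp [torusMul]

theorem torusMul_one (d : ℕ) : torusMul d 1 = ContinuousLinearMap.id ℂ _ := by
  ext1 u
  apply Lp.ext
  filter_upwards [torusMul_ae d 1 u] with ξ h1
  rw [h1]; simp

theorem fourierMultiplier_mul (d : ℕ) (f g : C(UnitAddTorus (Fin d), ℂ)) :
    fourierMultiplier d (f * g) = fourierMultiplier d f * fourierMultiplier d g := by
  ext1 u
  simp [fourierMultiplier, torusMul_mul, latticeFourier_fourierInv]

/-- The map `m ↦ m(D)` from symbols to operators, as a linear map. -/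
def fourierMultiplierLM (d : ℕ) :
    C(UnitAddTorus (Fin d), ℂ) →ₗ[ℂ] (l2Lattice d →L[ℂ] l2Lattice d) where
  toFun := fourierMultiplier d
  map_add' f g := by
    ext1 u
    simp [fourierMultiplier, torusMul_add]
  map_smul' c f := by
    ext1 u
    simp [fourierMultiplier, torusMul_smul]

theorem fourierMultiplier_one (d : ℕ) : fourierMultiplier d 1 = 1 := by
  ext1 u
  simp [fourierMultiplier, torusMul_one, latticeFourierInv_fourier]

/-- Each `u` is the norm-convergent sum of its point masses. -/
theorem l2Lattice_clm_ext {d : ℕ} {S T : l2Lattice d →L[ℂ] l2Lattice d}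
    (h : ∀ x, S (lp.single 2 x 1) = T (lp.single 2 x 1)) : S = T := by
  ext1 u
  have hu := lp.hasSum_single (p := 2) (by norm_num) u
  have key : ∀ x, S (lp.single 2 x (u x)) = T (lp.single 2 x (u x)) := by
    intro x
    have : (lp.single 2 x (u x) : l2Lattice d) = u x • lp.single 2 x (1 : ℂ) := by
      rw [← lp.single_smul]; simp
    rw [this, map_smul, map_smul, h]
  have h1 := S.hasSum hu
  have h2 := T.hasSum hu
  simp only [key] at h1
  exact h1.unique h2

theorem latticeFourier_single_ae (d : ℕ) (x : Fin d → ℤ) :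
    latticeFourier d (lp.single 2 x 1) =ᵐ[torusMeasure d] UnitAddTorus.mFourier (-x) := by
  rw [latticeFourier_single]
  exact ContinuousMap.coeFn_toLp (torusMeasure d) _

/-! ### The Laplacian and its resolvent as multipliers -/

theorem latticeShift_eq_fourierMultiplier (d : ℕ) (v : Fin d → ℤ) :
    latticeShift d v = fourierMultiplier d (UnitAddTorus.mFourier v) := by
  refine l2Lattice_clm_ext fun x => ?_
  have h : latticeShift d v (lp.single 2 x 1) = lp.single 2 (x - v) 1 := by
    ext y
    rw [latticeShift_apply]
    by_cases hy : y = x - v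
    · subst hy; simp
    · rw [lp.single_apply_ne _ _ _ hy, lp.single_apply_ne]
      intro h; apply hy; rw [← h, add_sub_cancel_right]
  rw [h, ← latticeFourierInv_fourier d (lp.single 2 (x - v) 1)]
  change _ = latticeFourierInv d (torusMul d _ (latticeFourier d _))
  congr 1
  apply Lp.ext
  filter_upwards [latticeFourier_single_ae d (x - v), latticeFourier_single_ae d x,
    torusMul_ae d (UnitAddTorus.mFourier v) (latticeFourier d (lp.single 2 x 1))] with ξ h1 h2 h3
  rw [h1, h3, h2, ← UnitAddTorus.mFourier_add]
  congr 2; abel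

/-- The symbol `h(ξ) = ∑ⱼ (2 - 2 cos 2πξⱼ)` of the negative discrete Laplacian. -/
def laplaceSymbol (d : ℕ) : C(UnitAddTorus (Fin d), ℝ) where
  toFun ξ := ∑ j, (2 - 2 * (fourier 1 (ξ j) : ℂ).re)
  continuous_toFun := by fun_prop

theorem laplaceSymbol_apply (d : ℕ) (ξ : UnitAddTorus (Fin d)) :
    laplaceSymbol d ξ = ∑ j, (2 - 2 * (fourier 1 (ξ j) : ℂ).re) := rfl

theorem complexSymbol_apply (d : ℕ) (χ : C(UnitAddTorus (Fin d), ℝ)) (ξ : UnitAddTorus (Fin d)) :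
    complexSymbol d χ ξ = (χ ξ : ℂ) := rfl

theorem laplaceSymbol_nonneg (d : ℕ) (ξ : UnitAddTorus (Fin d)) : 0 ≤ laplaceSymbol d ξ := by
  rw [laplaceSymbol_apply]
  refine Finset.sum_nonneg fun j _ => ?_
  have h := Complex.re_le_norm (fourier 1 (ξ j) : ℂ)
  rw [fourier_apply, Circle.norm_coe] at h
  rw [fourier_apply]
  linarith

theorem negLaplacian_eq_fourierMultiplier (d : ℕ) :
    negLaplacian d = fourierMultiplier d (complexSymbol d (laplaceSymbol d)) := by
  have h : complexSymbol d (laplaceSymbol d) = -∑ j : Fin d,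
      ((UnitAddTorus.mFourier (Pi.single j 1) - 1) +
        (UnitAddTorus.mFourier (-Pi.single j 1) - 1)) := by
    ext ξ
    rw [complexSymbol_apply, laplaceSymbol_apply]
    simp only [ContinuousMap.neg_apply, ContinuousMap.sum_apply, ContinuousMap.add_apply,
      ContinuousMap.sub_apply, ContinuousMap.one_apply, UnitAddTorus.mFourier_neg,
      UnitAddTorus.mFourier_single, ← Finset.sum_neg_distrib, Complex.ofReal_sum]
    refine Finset.sum_congr rfl fun j _ => ?_
    have := Complex.add_conj (fourier 1 (ξ j) : ℂ)
    push_cast at this ⊢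
    linear_combination this
  change _ = fourierMultiplierLM d _
  rw [h]
  have h1 : ContinuousLinearMap.id ℂ (l2Lattice d) = fourierMultiplierLM d 1 :=
    (fourierMultiplier_one d).symm
  have h2 : ∀ v, latticeShift d v = fourierMultiplierLM d (UnitAddTorus.mFourier v) :=
    latticeShift_eq_fourierMultiplier d
  simp only [map_neg, map_sum, map_add, map_sub, negLaplacian, h1, h2]

/-- The symbol `(h - z)⁻¹` of the resolvent; meaningful where `h - z` has no zero. -/
def resolventSymbol (d : ℕ) (z : ℂ) (hz : ∀ ξ, (laplaceSymbol d ξ : ℂ) - z ≠ 0) :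
    C(UnitAddTorus (Fin d), ℂ) where
  toFun ξ := ((laplaceSymbol d ξ : ℂ) - z)⁻¹
  continuous_toFun := by
    refine Continuous.inv₀ ?_ hz
    have := (laplaceSymbol d).continuous
    fun_prop

theorem negLaplacian_sub_eq (d : ℕ) (z : ℂ) :
    negLaplacian d - z • (1 : l2Lattice d →L[ℂ] l2Lattice d) =
      fourierMultiplier d (complexSymbol d (laplaceSymbol d) - z • 1) := by
  change _ = fourierMultiplierLM d _
  rw [map_sub, map_smul, negLaplacian_eq_fourierMultiplier, ← fourierMultiplier_one]
  rfl

theorem resolventSymbol_mul (d : ℕ) (z : ℂ) (hz : ∀ ξ, (laplaceSymbol d ξ : ℂ) - z ≠ 0) :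
    resolventSymbol d z hz * (complexSymbol d (laplaceSymbol d) - z • 1) = 1 := by
  ext ξ
  simpa [resolventSymbol, complexSymbol_apply] using inv_mul_cancel₀ (hz ξ)

theorem resolvent_mul_negLaplacian_sub (d : ℕ) (z : ℂ)
    (hz : ∀ ξ, (laplaceSymbol d ξ : ℂ) - z ≠ 0) :
    fourierMultiplier d (resolventSymbol d z hz) *
      (negLaplacian d - z • (1 : l2Lattice d →L[ℂ] l2Lattice d)) = 1 := by
  rw [negLaplacian_sub_eq, ← fourierMultiplier_mul, resolventSymbol_mul, fourierMultiplier_one]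

theorem negLaplacian_sub_mul_resolvent (d : ℕ) (z : ℂ)
    (hz : ∀ ξ, (laplaceSymbol d ξ : ℂ) - z ≠ 0) :
    (negLaplacian d - z • (1 : l2Lattice d →L[ℂ] l2Lattice d)) *
      fourierMultiplier d (resolventSymbol d z hz) = 1 := by
  rw [negLaplacian_sub_eq, ← fourierMultiplier_mul, mul_comm, resolventSymbol_mul,
    fourierMultiplier_one]

theorem laplaceSymbol_sub_ne_zero (d : ℕ) {z : ℂ} (hz : z.im ≠ 0) (ξ : UnitAddTorus (Fin d)) :
    (laplaceSymbol d ξ : ℂ) - z ≠ 0 := by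
  intro h
  apply hz
  have := congrArg Complex.im h
  simpa using this

theorem freeResolvent_eq (d : ℕ) {z : ℂ} (hz : z.im ≠ 0) :
    freeResolvent d z =
      fourierMultiplier d (resolventSymbol d z (laplaceSymbol_sub_ne_zero d hz)) := by
  have h := isUnit_negLaplacian_sub d z hz
  have h1 := resolvent_mul_negLaplacian_sub d z (laplaceSymbol_sub_ne_zero d hz)
  calc freeResolvent d z = 1 * freeResolvent d z := (one_mul _).symm
    _ = _ := by rw [← h1, mul_assoc, freeResolvent, Ring.mul_inverse_cancel _ h, mul_one]

theorem fourierMultiplier_comp_freeResolvent (d : ℕ) {z : ℂ} (hz : z.im ≠ 0)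
    (χ : C(UnitAddTorus (Fin d), ℂ)) :
    fourierMultiplier d χ ∘L freeResolvent d z =
      fourierMultiplier d (χ * resolventSymbol d z (laplaceSymbol_sub_ne_zero d hz)) := by
  rw [freeResolvent_eq d hz, fourierMultiplier_mul]; rfl

/-! ### Finitely supported test functions -/

/-- The trigonometric polynomial `∑_{x ∈ T} c(x) e^{-2πi x·ξ}`. -/
def trigPoly {d : ℕ} (T : Finset (Fin d → ℤ)) (c : (Fin d → ℤ) → ℂ) :
    C(UnitAddTorus (Fin d), ℂ) :=
  ∑ x ∈ T, c x • UnitAddTorus.mFourier (-x)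

/-- The finitely supported function `∑_{x ∈ T} c(x) δ_x` in `ℓ²(ℤᵈ)`. -/
def finsuppVec {d : ℕ} (T : Finset (Fin d → ℤ)) (c : (Fin d → ℤ) → ℂ) : l2Lattice d :=
  ∑ x ∈ T, lp.single 2 x (c x)

theorem finsuppVec_apply {d : ℕ} (T : Finset (Fin d → ℤ)) (c : (Fin d → ℤ) → ℂ)
    (x : Fin d → ℤ) [Decidable (x ∈ T)] : finsuppVec T c x = if x ∈ T then c x else 0 := by
  classical
  rw [finsuppVec, lp.coeFn_sum, Finset.sum_apply]
  simp only [lp.coeFn_single, Pi.single_apply]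
  rw [Finset.sum_ite_eq]
  congr

theorem norm_finsuppVec_sq {d : ℕ} (T : Finset (Fin d → ℤ)) (c : (Fin d → ℤ) → ℂ) :
    ‖finsuppVec T c‖ ^ 2 = ∑ x ∈ T, ‖c x‖ ^ 2 := by
  have := lp.norm_sum_single (p := 2) (E := fun _ : Fin d → ℤ => ℂ) (by norm_num) c T
  simpa [finsuppVec] using this

theorem inner_finsuppVec {d : ℕ} (T : Finset (Fin d → ℤ)) (c : (Fin d → ℤ) → ℂ)
    (u : l2Lattice d) :
    inner ℂ (finsuppVec T c) u = ∑ x ∈ T, (starRingEnd ℂ) (c x) * u x := by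
  rw [finsuppVec, sum_inner]
  refine Finset.sum_congr rfl fun x _ => ?_
  rw [lp.inner_single_left, RCLike.inner_apply, mul_comm]

theorem latticeFourier_finsuppVec_ae {d : ℕ} (T : Finset (Fin d → ℤ)) (c : (Fin d → ℤ) → ℂ) :
    latticeFourier d (finsuppVec T c) =ᵐ[torusMeasure d] trigPoly T c := by
  have h : latticeFourier d (finsuppVec T c) =
      ContinuousMap.toLp 2 (torusMeasure d) ℂ (trigPoly T c) := by
    rw [finsuppVec, trigPoly, map_sum, map_sum]
    refine Finset.sum_congr rfl fun x _ => ?_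
    have : (lp.single 2 x (c x) : l2Lattice d) = c x • lp.single 2 x (1 : ℂ) := by
      rw [← lp.single_smul]; simp
    rw [this, map_smul, map_smul, latticeFourier_single]
    rfl
  rw [h]
  exact ContinuousMap.coeFn_toLp (torusMeasure d) _

/-- Plancherel. All later bounds on operators are read off from these integrals. -/
theorem inner_fourierMultiplier_finsuppVec {d : ℕ} (T : Finset (Fin d → ℤ))
    (c : (Fin d → ℤ) → ℂ) (m : C(UnitAddTorus (Fin d), ℂ)) :
    inner ℂ (finsuppVec T c) (fourierMultiplier d m (finsuppVec T c)) =
      ∫ ξ, m ξ * (‖trigPoly T c ξ‖ ^ 2 : ℝ) ∂(torusMeasure d) := by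
  rw [← inner_latticeFourier]
  change inner ℂ _ (latticeFourier d (latticeFourierInv d (torusMul d m (latticeFourier d _)))) = _
  rw [latticeFourier_fourierInv, L2.inner_def]
  refine integral_congr_ae ?_
  filter_upwards [latticeFourier_finsuppVec_ae T c,
    torusMul_ae d m (latticeFourier d (finsuppVec T c))] with ξ h1 h2
  rw [h2, h1, RCLike.inner_apply, mul_assoc, Complex.mul_conj, Complex.normSq_eq_norm_sq]

/-! ### Aligned phases and the lower bound for the resolvent form -/

theorem exists_coe_eq_abs_eq_norm (θ : UnitAddCircle) :
    ∃ t : ℝ, (t : UnitAddCircle) = θ ∧ |t| = ‖θ‖ := by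
  induction θ using QuotientAddGroup.induction_on with
  | H t =>
    refine ⟨t - round t, ?_, ?_⟩
    · have h : ((round t : ℝ) : UnitAddCircle) = 0 := by
        have := AddCircle.coe_eq_zero_iff (1 : ℝ) (x := (round t : ℝ))
        exact this.2 ⟨round t, by simp⟩
      change ((t - round t : ℝ) : UnitAddCircle) = _
      rw [AddCircle.coe_sub, h, sub_zero]
    · exact (UnitAddCircle.norm_eq (x := t)).symm

theorem fourier_one_coe_re (t : ℝ) :
    (fourier 1 (t : UnitAddCircle) : ℂ).re = Real.cos (2 * Real.pi * t) := by
  rw [fourier_coe_apply]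
  have : (2 * Real.pi * Complex.I * ((1 : ℤ) : ℂ) * t / ((1 : ℝ) : ℂ) : ℂ) =
      ((2 * Real.pi * t : ℝ) : ℂ) * Complex.I := by push_cast; ring
  rw [this, Complex.exp_ofReal_mul_I_re]

theorem half_le_fourier_one_re {θ : UnitAddCircle} (h : ‖θ‖ ≤ 1 / 6) :
    1 / 2 ≤ (fourier 1 θ : ℂ).re := by
  obtain ⟨t, rfl, ht⟩ := exists_coe_eq_abs_eq_norm θ
  rw [fourier_one_coe_re, ← Real.cos_pi_div_three, ← Real.cos_abs (2 * Real.pi * t)]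
  have hp := Real.pi_pos
  apply Real.cos_le_cos_of_nonneg_of_le_pi (abs_nonneg _) (by linarith)
  rw [abs_mul, ht, abs_of_pos (by positivity : 0 < 2 * Real.pi)]
  nlinarith

theorem mFourier_eq_fourier_sum {d : ℕ} (x : Fin d → ℤ) (η : UnitAddTorus (Fin d)) :
    UnitAddTorus.mFourier x η = fourier 1 (∑ j, x j • η j) := by
  have key : ∀ s : Finset (Fin d), ∏ j ∈ s, (fourier (x j) (η j) : ℂ) =
      fourier 1 (∑ j ∈ s, x j • η j) := by
    classical
    intro s
    induction s using Finset.induction_on with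
    | empty => simp
    | insert j s hj ih =>
      rw [Finset.prod_insert hj, Finset.sum_insert hj, ih]
      simp [fourier_apply, AddCircle.toCircle_add]
  exact key Finset.univ

theorem integrable_torus_of_continuous {d : ℕ} {F : Type*} [NormedAddCommGroup F]
    {f : UnitAddTorus (Fin d) → F} (hf : Continuous f) : Integrable f (torusMeasure d) :=
  hf.integrable_of_hasCompactSupport (HasCompactSupport.of_compactSpace f)

/-- Coefficients `a(x) e^{2πi x·ξ₀}`. -/
def modulate {d : ℕ} (a : (Fin d → ℤ) → ℝ) (ξ₀ : UnitAddTorus (Fin d)) (x : Fin d → ℤ) : ℂ :=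
  (a x : ℂ) * UnitAddTorus.mFourier x ξ₀

theorem norm_mFourier_apply {d : ℕ} (x : Fin d → ℤ) (ξ : UnitAddTorus (Fin d)) :
    ‖UnitAddTorus.mFourier x ξ‖ = 1 := by
  rw [mFourier_eq_fourier_sum, fourier_apply, Circle.norm_coe]

theorem norm_modulate {d : ℕ} (a : (Fin d → ℤ) → ℝ) (ξ₀ : UnitAddTorus (Fin d))
    (x : Fin d → ℤ) : ‖modulate a ξ₀ x‖ = |a x| := by
  rw [modulate, norm_mul, norm_mFourier_apply, mul_one, Complex.norm_real, Real.norm_eq_abs]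

theorem trigPoly_modulate {d : ℕ} (T : Finset (Fin d → ℤ)) (a : (Fin d → ℤ) → ℝ)
    (ξ₀ η : UnitAddTorus (Fin d)) :
    trigPoly T (modulate a ξ₀) (ξ₀ + η) = ∑ x ∈ T, (a x : ℂ) * UnitAddTorus.mFourier (-x) η := by
  rw [trigPoly, ContinuousMap.sum_apply]
  refine Finset.sum_congr rfl fun x _ => ?_
  have h1 : UnitAddTorus.mFourier (-x) (ξ₀ + η) =
      UnitAddTorus.mFourier (-x) ξ₀ * UnitAddTorus.mFourier (-x) η := by
    rw [mFourier_eq_fourier_sum, mFourier_eq_fourier_sum, mFourier_eq_fourier_sum]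
    simp only [Pi.add_apply, smul_add, Finset.sum_add_distrib]
    simp only [fourier_apply, one_smul, AddCircle.toCircle_add, Circle.coe_mul]
  have h2 : UnitAddTorus.mFourier x ξ₀ * UnitAddTorus.mFourier (-x) ξ₀ = 1 := by
    rw [← UnitAddTorus.mFourier_add, add_neg_cancel, UnitAddTorus.mFourier_zero]
    rfl
  rw [ContinuousMap.smul_apply, smul_eq_mul, h1, modulate]
  linear_combination (a x : ℂ) * UnitAddTorus.mFourier (-x) η * h2

/-- The modulation recentres the transform at `ξ₀`. A phase within a sixth of a period has cosine at
least `cos (π/3) = 1/2`, so the terms cannot cancel. -/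
theorem half_sum_le_norm_trigPoly {d : ℕ} (T : Finset (Fin d → ℤ)) (a : (Fin d → ℤ) → ℝ)
    (ha : ∀ x ∈ T, 0 ≤ a x) (ξ₀ η : UnitAddTorus (Fin d))
    (hη : ∀ x ∈ T, ‖∑ j, x j • η j‖ ≤ 1 / 6) :
    (∑ x ∈ T, a x) / 2 ≤ ‖trigPoly T (modulate a ξ₀) (ξ₀ + η)‖ := by
  refine le_trans ?_ (Complex.re_le_norm _)
  rw [trigPoly_modulate, Complex.re_sum, Finset.sum_div]
  refine Finset.sum_le_sum fun x hx => ?_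
  rw [UnitAddTorus.mFourier_neg, Complex.re_ofReal_mul, Complex.conj_re, mFourier_eq_fourier_sum]
  have := half_le_fourier_one_re (hη x hx)
  nlinarith [ha x hx]

/-- The imaginary part of `1/(h - E - iε)` is a Poisson kernel; its positivity excludes cancellation
between frequencies. -/
theorem mul_resolventSymbol_im {d : ℕ} (χ : C(UnitAddTorus (Fin d), ℝ)) (E ε t : ℝ)
    (hz : ∀ ξ, (laplaceSymbol d ξ : ℂ) - (⟨E, ε⟩ : ℂ) ≠ 0) (ξ : UnitAddTorus (Fin d)) :
    ((complexSymbol d χ * resolventSymbol d ⟨E, ε⟩ hz) ξ * (t : ℂ)).im =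
      χ ξ * (ε / ((laplaceSymbol d ξ - E) ^ 2 + ε ^ 2)) * t := by
  have h : ((laplaceSymbol d ξ : ℂ) - (⟨E, ε⟩ : ℂ)) = ⟨laplaceSymbol d ξ - E, -ε⟩ := by
    apply Complex.ext <;> simp
  rw [ContinuousMap.mul_apply, complexSymbol_apply, Complex.im_mul_ofReal, Complex.im_ofReal_mul]
  change χ ξ * (((laplaceSymbol d ξ : ℂ) - (⟨E, ε⟩ : ℂ))⁻¹).im * t = _
  rw [h, Complex.inv_im, Complex.normSq_mk]
  congr 2
  ring_nf

theorem exists_le_norm_inner_resolvent {d : ℕ} (χ : C(UnitAddTorus (Fin d), ℝ))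
    (hχ : ∀ ξ, 0 ≤ χ ξ) (T : Finset (Fin d → ℤ)) (a : (Fin d → ℤ) → ℝ) (ha : ∀ x ∈ T, 0 ≤ a x)
    (ξ₀ : UnitAddTorus (Fin d)) (S : Set (UnitAddTorus (Fin d))) (hS : MeasurableSet S)
    (E ε : ℝ) (hε : 0 < ε) (h1 : ∀ η ∈ S, χ (ξ₀ + η) = 1)
    (h2 : ∀ η ∈ S, |laplaceSymbol d (ξ₀ + η) - E| ≤ ε)
    (h3 : ∀ η ∈ S, ∀ x ∈ T, ‖∑ j, x j • η j‖ ≤ 1 / 6) :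
    ∃ z : ℂ, z.im ≠ 0 ∧ (torusMeasure d).real S * (∑ x ∈ T, a x) ^ 2 / (8 * ε) ≤
      ‖inner ℂ (finsuppVec T (modulate a ξ₀))
        ((fourierMultiplier d (complexSymbol d χ) ∘L freeResolvent d z)
          (finsuppVec T (modulate a ξ₀)))‖ := by
  have hz : (⟨E, ε⟩ : ℂ).im ≠ 0 := hε.ne'
  refine ⟨⟨E, ε⟩, hz, ?_⟩
  rw [fourierMultiplier_comp_freeResolvent d hz, inner_fourierMultiplier_finsuppVec]
  refine le_trans ?_ (Complex.abs_im_le_norm _)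
  refine le_trans ?_ (le_abs_self _)
  set p := trigPoly T (modulate a ξ₀)
  set m := complexSymbol d χ * resolventSymbol d ⟨E, ε⟩ (laplaceSymbol_sub_ne_zero d hz)
  have hint : Integrable (fun ξ => m ξ * ((‖p ξ‖ ^ 2 : ℝ) : ℂ)) (torusMeasure d) :=
    integrable_torus_of_continuous (by fun_prop)
  have him : (∫ ξ, m ξ * ((‖p ξ‖ ^ 2 : ℝ) : ℂ) ∂(torusMeasure d)).im =
      ∫ ξ, χ ξ * (ε / ((laplaceSymbol d ξ - E) ^ 2 + ε ^ 2)) * ‖p ξ‖ ^ 2 ∂(torusMeasure d) := by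
    have := integral_im hint
    simp only [RCLike.im_to_complex] at this
    rw [← this]
    refine integral_congr_ae (Filter.Eventually.of_forall fun ξ => ?_)
    exact mul_resolventSymbol_im χ E ε _ _ ξ
  -- Translation invariance of Haar measure moves the centre `ξ₀` to the origin.
  rw [him, ← integral_add_left_eq_self _ ξ₀]
  set f : UnitAddTorus (Fin d) → ℝ := fun η => χ (ξ₀ + η) *
    (ε / ((laplaceSymbol d (ξ₀ + η) - E) ^ 2 + ε ^ 2)) * ‖p (ξ₀ + η)‖ ^ 2 with hf
  have hpos : ∀ x : ℝ, 0 < x ^ 2 + ε ^ 2 := fun x => by positivity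
  have hfc : Continuous f := by
    have h1 := χ.continuous
    have h2 := (laplaceSymbol d).continuous
    have h3 := p.continuous
    have h4 : Continuous fun η => ε / ((laplaceSymbol d (ξ₀ + η) - E) ^ 2 + ε ^ 2) :=
      Continuous.div (by fun_prop) (by fun_prop) (fun η => (hpos _).ne')
    fun_prop
  have hfi := integrable_torus_of_continuous hfc
  have hf0 : ∀ η, 0 ≤ f η := fun η =>
    mul_nonneg (mul_nonneg (hχ _) (div_nonneg hε.le (hpos _).le)) (sq_nonneg _)
  have hsum : 0 ≤ ∑ x ∈ T, a x := Finset.sum_nonneg ha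
  calc (torusMeasure d).real S * (∑ x ∈ T, a x) ^ 2 / (8 * ε)
      = ∫ _ in S, (∑ x ∈ T, a x) ^ 2 / (8 * ε) ∂(torusMeasure d) := by
        rw [setIntegral_const, smul_eq_mul]; ring
    _ ≤ ∫ η in S, f η ∂(torusMeasure d) := by
        refine setIntegral_mono_on (integrable_const _) hfi.integrableOn hS fun η hη => ?_
        have e1 := half_sum_le_norm_trigPoly T a ha ξ₀ η (h3 η hη)
        have e2 : (∑ x ∈ T, a x) ^ 2 / 4 ≤ ‖p (ξ₀ + η)‖ ^ 2 := by
          calc _ = ((∑ x ∈ T, a x) / 2) ^ 2 := by ring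
            _ ≤ _ := pow_le_pow_left₀ (by positivity) e1 2
        -- Within distance `ε` of the energy the denominator is at most `2ε²`.
        have e3 : 1 / (2 * ε) ≤ ε / ((laplaceSymbol d (ξ₀ + η) - E) ^ 2 + ε ^ 2) := by
          rw [div_le_div_iff₀ (by positivity) (hpos _)]
          have := sq_le_sq.2 ((h2 η hη).trans (le_abs_self ε))
          nlinarith
        rw [hf]
        simp only [h1 η hη, one_mul]
        calc (∑ x ∈ T, a x) ^ 2 / (8 * ε) = 1 / (2 * ε) * ((∑ x ∈ T, a x) ^ 2 / 4) := by
              field_simp; ring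
          _ ≤ _ := mul_le_mul e3 e2 (by positivity) (by positivity)
    _ ≤ ∫ η, f η ∂(torusMeasure d) :=
        setIntegral_le_integral hfi (Filter.Eventually.of_forall hf0)

/-! ### From weighted operator bounds to the box inequality -/

theorem inner_latticeMul_ofReal {d : ℕ} {w : (Fin d → ℤ) → ℝ}
    (hw : Memℓp (fun x => (w x : ℂ)) ∞) (u v : l2Lattice d) :
    inner ℂ (latticeMul d (fun x => (w x : ℂ)) u) v =
      inner ℂ u (latticeMul d (fun x => (w x : ℂ)) v) := by
  rw [lp.inner_eq_tsum, lp.inner_eq_tsum]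
  refine tsum_congr fun x => ?_
  rw [latticeMul_apply d _ hw, latticeMul_apply d _ hw]
  simp only [RCLike.inner_apply, map_mul, Complex.conj_ofReal]
  ring

/-- Write the test vector as `w · (c/w)`, which is possible because `w` has no zero on `T`, and move
one factor `w` across the inner product. -/
theorem norm_inner_le_of_norm_weighted_le {d : ℕ} {w : (Fin d → ℤ) → ℝ}
    (hw : Memℓp (fun x => (w x : ℂ)) ∞) (X : l2Lattice d →L[ℂ] l2Lattice d) {C : ℝ}
    (hC : ‖latticeMul d (fun x => (w x : ℂ)) ∘L X ∘L latticeMul d (fun x => (w x : ℂ))‖ ≤ C)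
    (T : Finset (Fin d → ℤ)) (hT : ∀ x ∈ T, w x ≠ 0) (c : (Fin d → ℤ) → ℂ) :
    ‖inner ℂ (finsuppVec T c) (X (finsuppVec T c))‖ ≤ C * ∑ x ∈ T, ‖c x‖ ^ 2 / w x ^ 2 := by
  classical
  set f := finsuppVec T (fun x => c x / w x) with hf
  have h : latticeMul d (fun x => (w x : ℂ)) f = finsuppVec T c := by
    ext x
    rw [latticeMul_apply d _ hw, hf, finsuppVec_apply, finsuppVec_apply]
    split_ifs with hx
    · have : (w x : ℂ) ≠ 0 := by exact_mod_cast hT x hx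
      field_simp
    · simp
  have hn : ∑ x ∈ T, ‖c x‖ ^ 2 / w x ^ 2 = ‖f‖ ^ 2 := by
    rw [hf, norm_finsuppVec_sq]
    refine Finset.sum_congr rfl fun x _ => ?_
    rw [norm_div, div_pow, Complex.norm_real, Real.norm_eq_abs, sq_abs]
  rw [hn, ← h, inner_latticeMul_ofReal hw]
  calc _ ≤ ‖f‖ * ‖(latticeMul d (fun x => (w x : ℂ)) ∘L X ∘L
        latticeMul d (fun x => (w x : ℂ))) f‖ := norm_inner_le_norm _ _
    _ ≤ ‖f‖ * (C * ‖f‖) := by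
        gcongr
        exact (ContinuousLinearMap.le_opNorm _ _).trans (by gcongr)
    _ = C * ‖f‖ ^ 2 := by ring

theorem sqrt_abs_memℓp {d : ℕ} {V : (Fin d → ℤ) → ℝ} (hV : Memℓp V ∞) :
    Memℓp (fun x => (Real.sqrt |V x| : ℂ)) ∞ := by
  obtain ⟨K, hK⟩ := memℓp_infty_iff.1 hV
  refine memℓp_infty ⟨Real.sqrt K, ?_⟩
  rintro _ ⟨x, rfl⟩
  simp only [Complex.norm_real, Real.norm_eq_abs, abs_of_nonneg (Real.sqrt_nonneg _)]
  exact Real.sqrt_le_sqrt (hK ⟨x, rfl⟩)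

theorem BirmanSchwingerBound.exists_norm_inner_le {d : ℕ} {V : (Fin d → ℤ) → ℝ}
    (h : BirmanSchwingerBound d V) (hV : Memℓp V ∞) :
    ∃ C : ℝ, 0 ≤ C ∧ ∀ z : ℂ, z.im ≠ 0 → ∀ (T : Finset (Fin d → ℤ)), (∀ x ∈ T, V x ≠ 0) →
      ∀ c : (Fin d → ℤ) → ℂ, ‖inner ℂ (finsuppVec T c) (freeResolvent d z (finsuppVec T c))‖ ≤
        C * ∑ x ∈ T, ‖c x‖ ^ 2 / |V x| := by
  obtain ⟨C, hC⟩ := h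
  refine ⟨C, ?_, fun z hz T hT c => ?_⟩
  · exact (norm_nonneg _).trans (hC ⟨⟨Complex.I, by simp⟩, rfl⟩)
  · have := norm_inner_le_of_norm_weighted_le (w := fun x => Real.sqrt |V x|) (sqrt_abs_memℓp hV)
      (freeResolvent d z) (hC ⟨⟨z, hz⟩, rfl⟩) T
      (fun x hx => (Real.sqrt_pos.2 (abs_pos.2 (hT x hx))).ne') c
    simpa only [Real.sq_sqrt (abs_nonneg _)] using this

/-- The lower bound `|S| |T|² / (8ε)` meets the upper bound `C |T| / A`; one factor `|T|` cancels.
Every failure of (BS) in dimension at least three contradicts this inequality. -/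
theorem BirmanSchwingerBound.box_bound {d : ℕ} {V : (Fin d → ℤ) → ℝ}
    (h : BirmanSchwingerBound d V) (hV : Memℓp V ∞) :
    ∃ C : ℝ, ∀ (T : Finset (Fin d → ℤ)) (A : ℝ), T.Nonempty → 0 < A → (∀ x ∈ T, A ≤ |V x|) →
      ∀ (ξ₀ : UnitAddTorus (Fin d)) (S : Set (UnitAddTorus (Fin d))), MeasurableSet S →
      ∀ (E ε : ℝ), 0 < ε → (∀ η ∈ S, |laplaceSymbol d (ξ₀ + η) - E| ≤ ε) →
      (∀ η ∈ S, ∀ x ∈ T, ‖∑ j, x j • η j‖ ≤ 1 / 6) →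
      A * T.card * (torusMeasure d).real S ≤ C * ε := by
  obtain ⟨C, hC0, hC⟩ := h.exists_norm_inner_le hV
  refine ⟨8 * C, fun T A hT hA hAV ξ₀ S hS E ε hε h2 h3 => ?_⟩
  obtain ⟨z, hz, hle⟩ := exists_le_norm_inner_resolvent (1 : C(UnitAddTorus (Fin d), ℝ))
    (fun _ => zero_le_one) T (fun _ => 1) (fun _ _ => zero_le_one) ξ₀ S hS E ε hε
    (fun _ _ => rfl) h2 h3
  have hone : complexSymbol d (1 : C(UnitAddTorus (Fin d), ℝ)) = 1 := by
    ext ξ; simp [complexSymbol_apply]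
  rw [hone, fourierMultiplier_one] at hle
  have h4 := hle.trans (hC z hz T
    (fun x hx => abs_pos.1 (hA.trans_le (hAV x hx))) (modulate (fun _ => 1) ξ₀))
  have h5 : ∑ x ∈ T, ‖modulate (fun _ => (1 : ℝ)) ξ₀ x‖ ^ 2 / |V x| ≤ T.card * (1 / A) := by
    rw [← nsmul_eq_mul]
    refine Finset.sum_le_card_nsmul _ _ _ fun x hx => ?_
    rw [norm_modulate, abs_one, one_pow]
    exact one_div_le_one_div_of_le hA (hAV x hx)
  have h6 := h4.trans (mul_le_mul_of_nonneg_left h5 hC0)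
  have hc : (0 : ℝ) < T.card := by exact_mod_cast hT.card_pos
  simp only [Finset.sum_const, nsmul_eq_mul, mul_one] at h6
  rw [div_le_iff₀ (by positivity)] at h6
  have h7 : A * T.card * (torusMeasure d).real S * T.card ≤ 8 * C * ε * T.card := by
    calc _ = A * ((torusMeasure d).real S * (T.card : ℝ) ^ 2) := by ring
      _ ≤ A * (C * (T.card * (1 / A)) * (8 * ε)) := by gcongr
      _ = _ := by field_simp
  exact le_of_mul_le_mul_right h7 hc

/-! ### Boxes and sheared boxes in the torus -/

theorem torusMeasure_real_box {d : ℕ} (r : Fin d → ℝ) (h0 : ∀ j, 0 ≤ r j)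
    (h1 : ∀ j, r j ≤ 1 / 2) :
    (torusMeasure d).real {η | ∀ j, ‖η j‖ ≤ r j} = ∏ j, 2 * r j := by
  have hset : {η : UnitAddTorus (Fin d) | ∀ j, ‖η j‖ ≤ r j} =
      Set.univ.pi fun j => Metric.closedBall (0 : UnitAddCircle) (r j) := by
    ext η; simp [Set.mem_pi]
  rw [hset, Measure.real, Measure.pi_pi, ENNReal.toReal_prod]
  refine Finset.prod_congr rfl fun j _ => ?_
  have h2 := AddCircle.volume_closedBall (T := (1 : ℝ)) (x := 0) (r j)
  rw [AddCircle.volume_eq_smul_haarAddCircle, ENNReal.ofReal_one, one_smul,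
    min_eq_right (by linarith [h1 j])] at h2
  rw [h2, ENNReal.toReal_ofReal (by linarith [h0 j])]

theorem measurableSet_torus_box {d : ℕ} (r : Fin d → ℝ) :
    MeasurableSet {η : UnitAddTorus (Fin d) | ∀ j, ‖η j‖ ≤ r j} := by
  have : IsClosed {η : UnitAddTorus (Fin d) | ∀ j, ‖η j‖ ≤ r j} := by
    simp only [Set.ofPred_forall]
    exact isClosed_iInter fun j => isClosed_le (by fun_prop) continuous_const
  exact this.measurableSet

/-- The endomorphism `(η₀, η₁, …, η_k) ↦ (η₀ + ⋯ + η_k, η₁, …, η_k)` of the torus. -/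
def torusShear (k : ℕ) : UnitAddTorus (Fin (k + 1)) →+ UnitAddTorus (Fin (k + 1)) where
  toFun η := Fin.cons (∑ j, η j) fun i => η i.succ
  map_zero' := by
    funext j
    refine Fin.cases ?_ (fun i => ?_) j <;> simp
  map_add' η ζ := by
    funext j
    refine Fin.cases ?_ (fun i => ?_) j
    · simp [Finset.sum_add_distrib]
    · simp

/-- A continuous surjective endomorphism of a compact group preserves its Haar probability measure.
-/
theorem measurePreserving_torusShear (k : ℕ) :
    MeasurePreserving (torusShear k) (torusMeasure (k + 1)) (torusMeasure (k + 1)) := by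
  refine AddMonoidHom.measurePreserving ?_ ?_ rfl
  · refine continuous_pi fun j => ?_
    refine Fin.cases ?_ (fun i => ?_) j
    · change Continuous fun η : UnitAddTorus (Fin (k + 1)) => ∑ j, η j
      fun_prop
    · change Continuous fun η : UnitAddTorus (Fin (k + 1)) => η i.succ
      fun_prop
  · intro ζ
    refine ⟨Fin.cons (ζ 0 - ∑ i : Fin k, ζ i.succ) fun i => ζ i.succ, ?_⟩
    funext j
    refine Fin.cases ?_ (fun i => ?_) j
    · change ∑ j, (Fin.cons (ζ 0 - ∑ i : Fin k, ζ i.succ) (fun i => ζ i.succ) :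
        UnitAddTorus (Fin (k + 1))) j = ζ 0
      rw [Fin.sum_univ_succ]
      simp
    · rfl

/-- The frequencies `η` with `‖∑ⱼ ηⱼ‖ ≤ ρ` and `‖ηⱼ‖ ≤ σ` for `j ≥ 1`. -/
def shearBox (k : ℕ) (ρ σ : ℝ) : Set (UnitAddTorus (Fin (k + 1))) :=
  {η | ‖∑ j, η j‖ ≤ ρ ∧ ∀ i : Fin k, ‖η i.succ‖ ≤ σ}

theorem shearBox_eq_preimage (k : ℕ) (ρ σ : ℝ) : shearBox k ρ σ =
    torusShear k ⁻¹' {η | ∀ j, ‖η j‖ ≤ (Fin.cons ρ fun _ => σ : Fin (k + 1) → ℝ) j} := by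
  ext η
  simp only [shearBox, Set.mem_ofPred_eq, Set.mem_preimage, Fin.forall_fin_succ, Fin.cons_zero,
    Fin.cons_succ]
  rfl

theorem measurableSet_shearBox (k : ℕ) (ρ σ : ℝ) : MeasurableSet (shearBox k ρ σ) := by
  rw [shearBox_eq_preimage]
  exact (measurePreserving_torusShear k).measurable (measurableSet_torus_box _)

theorem torusMeasure_real_shearBox (k : ℕ) {ρ σ : ℝ} (hρ : 0 ≤ ρ) (hρ' : ρ ≤ 1 / 2)
    (hσ : 0 ≤ σ) (hσ' : σ ≤ 1 / 2) :
    (torusMeasure (k + 1)).real (shearBox k ρ σ) = 2 * ρ * (2 * σ) ^ k := by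
  rw [shearBox_eq_preimage, (measurePreserving_torusShear k).measureReal_preimage
    (measurableSet_torus_box _).nullMeasurableSet, torusMeasure_real_box]
  · simp [Fin.prod_univ_succ]
  · intro j; refine Fin.cases ?_ (fun i => ?_) j <;> simpa
  · intro j; refine Fin.cases ?_ (fun i => ?_) j <;> simpa using by linarith

theorem norm_le_of_mem_shearBox {k : ℕ} {ρ σ : ℝ} (hρ : 0 ≤ ρ) (hσ : 0 ≤ σ)
    {η : UnitAddTorus (Fin (k + 1))} (hη : η ∈ shearBox k ρ σ) (hk : 1 ≤ k) (j : Fin (k + 1)) :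
    ‖η j‖ ≤ ρ + k * σ := by
  have hk' : (1 : ℝ) ≤ k := by exact_mod_cast hk
  refine Fin.cases ?_ (fun i => ?_) j
  · have h : η 0 = ∑ j, η j - ∑ i : Fin k, η i.succ := by rw [Fin.sum_univ_succ]; abel
    rw [h]
    refine (norm_sub_le _ _).trans (add_le_add hη.1 ((norm_sum_le _ _).trans ?_))
    refine (Finset.sum_le_card_nsmul _ _ σ fun i _ => hη.2 i).trans ?_
    simp
  · have := hη.2 i
    nlinarith

/-- The identity `x·η = x₀ ∑ⱼ ηⱼ + ∑_{i ≥ 1} (xᵢ - x₀) ηᵢ` shows which lattice tube is dual to the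
sheared box. -/
theorem norm_sum_zsmul_le_of_mem_shearBox {k : ℕ} {ρ σ : ℝ}
    {η : UnitAddTorus (Fin (k + 1))} (hη : η ∈ shearBox k ρ σ) (x : Fin (k + 1) → ℤ)
    {M L : ℝ} (hM : |(x 0 : ℝ)| ≤ M) (hL : ∀ i : Fin k, |((x i.succ - x 0 : ℤ) : ℝ)| ≤ L)
    (hL0 : 0 ≤ L) :
    ‖∑ j, x j • η j‖ ≤ M * ρ + k * (L * σ) := by
  have h : ∑ j, x j • η j = x 0 • ∑ j, η j + ∑ i : Fin k, (x i.succ - x 0) • η i.succ := by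
    rw [Fin.sum_univ_succ, Fin.sum_univ_succ]
    simp only [sub_smul, Finset.sum_sub_distrib, smul_add, Finset.smul_sum]
    abel
  rw [h]
  refine (norm_add_le _ _).trans (add_le_add ?_ ((norm_sum_le _ _).trans ?_))
  · refine (norm_zsmul_le _ _).trans ?_
    rw [Int.norm_eq_abs]
    exact mul_le_mul hM hη.1 (norm_nonneg _) ((abs_nonneg _).trans hM)
  · refine (Finset.sum_le_card_nsmul _ _ (L * σ) fun i _ => ?_).trans (by simp)
    refine (norm_zsmul_le _ _).trans ?_
    rw [Int.norm_eq_abs]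
    exact mul_le_mul (hL i) (hη.2 i) (norm_nonneg _) hL0

/-! ### The symbol near its minimum and near the quarter point -/

/-- Each summand is at most `(2πt)² ≤ 40 t²`, as `π² ≤ 10`. -/
theorem laplaceSymbol_le {d : ℕ} (ξ : UnitAddTorus (Fin d)) {r : ℝ} (hr : ∀ j, ‖ξ j‖ ≤ r) :
    laplaceSymbol d ξ ≤ d * (40 * r ^ 2) := by
  rw [laplaceSymbol_apply]
  refine (Finset.sum_le_card_nsmul _ _ (40 * r ^ 2) fun j _ => ?_).trans (by simp)
  obtain ⟨t, ht, hn⟩ := exists_coe_eq_abs_eq_norm (ξ j)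
  have h1 : |t| ≤ r := hn.le.trans (hr j)
  rw [← ht, fourier_one_coe_re]
  have h2 := Real.one_sub_sq_div_two_le_cos (x := 2 * Real.pi * t)
  have h3 : t ^ 2 ≤ r ^ 2 := by rw [← sq_abs]; exact pow_le_pow_left₀ (abs_nonneg _) h1 2
  have h4 : Real.pi ^ 2 ≤ 10 := by nlinarith [Real.pi_lt_d2, Real.pi_pos]
  nlinarith [mul_le_mul h4 h3 (sq_nonneg t) (by norm_num)]

/-- The point `(1/4, …, 1/4)` of the torus. -/
def quarterPoint (d : ℕ) : UnitAddTorus (Fin d) := fun _ => ((1 / 4 : ℝ) : UnitAddCircle)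

theorem laplaceSymbol_quarterPoint_add {d : ℕ} (t : Fin d → ℝ) :
    laplaceSymbol d (quarterPoint d + fun j => ((t j : ℝ) : UnitAddCircle)) - 2 * d =
      2 * ∑ j, Real.sin (2 * Real.pi * t j) := by
  have h : ∀ j, (fourier 1 ((quarterPoint d + fun j => ((t j : ℝ) : UnitAddCircle)) j) : ℂ).re =
      -Real.sin (2 * Real.pi * t j) := by
    intro j
    change (fourier 1 (((1 / 4 : ℝ) : UnitAddCircle) + ((t j : ℝ) : UnitAddCircle)) : ℂ).re = _
    rw [← AddCircle.coe_add, fourier_one_coe_re, ← Real.cos_add_pi_div_two]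
    congr 1; ring
  rw [laplaceSymbol_apply]
  simp only [h, Finset.sum_sub_distrib, ← Finset.mul_sum, Finset.sum_neg_distrib]
  simp; ring

theorem exists_real_lift {d : ℕ} (η : UnitAddTorus (Fin d)) :
    ∃ t : Fin d → ℝ, η = (fun j => ((t j : ℝ) : UnitAddCircle)) ∧ ∀ j, |t j| = ‖η j‖ := by
  choose t ht using fun j => exists_coe_eq_abs_eq_norm (η j)
  exact ⟨t, funext fun j => (ht j).1.symm, fun j => (ht j).2⟩

/-- The sum of the small representatives stays within half a period, so it does not wrap around the
circle. -/
theorem abs_sum_lift_eq {d : ℕ} (t : Fin d → ℝ) {τ : ℝ} (ht : ∀ j, |t j| ≤ τ)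
    (hd : d * τ ≤ 1 / 2) : |∑ j, t j| = ‖∑ j, ((t j : ℝ) : UnitAddCircle)‖ := by
  have h : ∑ j, ((t j : ℝ) : UnitAddCircle) = ((∑ j, t j : ℝ) : UnitAddCircle) :=
    (map_sum (QuotientAddGroup.mk' (AddSubgroup.zmultiples (1 : ℝ))) t Finset.univ).symm
  rw [h, eq_comm, AddCircle.norm_coe_eq_abs_iff 1 one_ne_zero]
  refine (Finset.abs_sum_le_sum_abs _ _).trans ?_
  refine (Finset.sum_le_card_nsmul _ _ τ fun j _ => ht j).trans ?_
  simpa using hd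

theorem abs_sin_sub_self_le {u : ℝ} (hu : |u| ≤ 1) : |Real.sin u - u| ≤ |u| ^ 3 := by
  have h := Real.sin_bound hu
  have h1 : |Real.sin u - u| ≤ |Real.sin u - (u - u ^ 3 / 6)| + |u ^ 3 / 6| := by
    have h2 : Real.sin u - u = Real.sin u - (u - u ^ 3 / 6) + -(u ^ 3 / 6) := by ring
    rw [h2]
    exact (abs_add_le _ _).trans_eq (by rw [abs_neg])
  rw [abs_div, abs_pow, abs_of_pos (by norm_num : (0 : ℝ) < 6)] at h1
  have h2 : |u| ^ 5 ≤ |u| ^ 3 := pow_le_pow_of_le_one (abs_nonneg _) hu (by norm_num)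
  have h3 : 0 ≤ |u| ^ 3 := by positivity
  linarith

/-- The sine has no quadratic term: apart from the linear term `4π ∑ ηⱼ`, the error is cubic in `τ`.
-/
theorem abs_laplaceSymbol_quarterPoint_sub_le {d : ℕ} (η : UnitAddTorus (Fin d)) {ρ τ : ℝ}
    (hρ : ‖∑ j, η j‖ ≤ ρ) (hτ : ∀ j, ‖η j‖ ≤ τ) (hd : d * τ ≤ 1 / 2)
    (hτ1 : 2 * Real.pi * τ ≤ 1) :
    |laplaceSymbol d (quarterPoint d + η) - 2 * d| ≤
      4 * Real.pi * ρ + 2 * (d * (2 * Real.pi * τ) ^ 3) := by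
  obtain ⟨t, rfl, ht⟩ := exists_real_lift η
  have htτ : ∀ j, |t j| ≤ τ := fun j => (ht j).le.trans (hτ j)
  rw [← abs_sum_lift_eq t htτ hd] at hρ
  rw [laplaceSymbol_quarterPoint_add, abs_mul, abs_two]
  have hp := Real.pi_pos
  have h1 : |∑ j, Real.sin (2 * Real.pi * t j) - 2 * Real.pi * ∑ j, t j| ≤
      d * (2 * Real.pi * τ) ^ 3 := by
    rw [Finset.mul_sum, ← Finset.sum_sub_distrib]
    refine (Finset.abs_sum_le_sum_abs _ _).trans ?_
    refine (Finset.sum_le_card_nsmul _ _ ((2 * Real.pi * τ) ^ 3) fun j _ => ?_).trans (by simp)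
    have h2 : |2 * Real.pi * t j| ≤ 2 * Real.pi * τ := by
      rw [abs_mul, abs_of_pos (by positivity : 0 < 2 * Real.pi)]
      exact mul_le_mul_of_nonneg_left (htτ j) (by positivity)
    exact (abs_sin_sub_self_le (h2.trans hτ1)).trans (pow_le_pow_left₀ (abs_nonneg _) h2 3)
  have h3 : |2 * Real.pi * ∑ j, t j| ≤ 2 * Real.pi * ρ := by
    rw [abs_mul, abs_of_pos (by positivity : 0 < 2 * Real.pi)]
    exact mul_le_mul_of_nonneg_left hρ (by positivity)
  have h4 := abs_add_le (∑ j, Real.sin (2 * Real.pi * t j) - 2 * Real.pi * ∑ j, t j)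
    (2 * Real.pi * ∑ j, t j)
  rw [sub_add_cancel] at h4
  linarith

theorem abs_sin_add_sin_le (a b : ℝ) : |Real.sin a + Real.sin b| ≤ |a + b| := by
  have := Real.abs_sin_sub_sin_le a (-b)
  simpa using this

/-- For two variables no cubic error remains, because `|sin a + sin b| ≤ |a + b|`: the level set is
exactly straight. -/
theorem abs_laplaceSymbol_quarterPoint_sub_le_two (η : UnitAddTorus (Fin 2)) {ρ τ : ℝ}
    (hρ : ‖∑ j, η j‖ ≤ ρ) (hτ : ∀ j, ‖η j‖ ≤ τ) (hτ1 : τ ≤ 1 / 4) :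
    |laplaceSymbol 2 (quarterPoint 2 + η) - 4| ≤ 4 * Real.pi * ρ := by
  obtain ⟨t, rfl, ht⟩ := exists_real_lift η
  have htτ : ∀ j, |t j| ≤ τ := fun j => (ht j).le.trans (hτ j)
  rw [← abs_sum_lift_eq t htτ (by norm_num; linarith)] at hρ
  have h := laplaceSymbol_quarterPoint_add t
  have h4 : (2 : ℝ) * (2 : ℕ) = 4 := by norm_num
  rw [h4] at h
  rw [h, abs_mul, abs_two, Fin.sum_univ_two]
  rw [Fin.sum_univ_two] at hρ
  have hp := Real.pi_pos
  have h1 := abs_sin_add_sin_le (2 * Real.pi * t 0) (2 * Real.pi * t 1)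
  rw [← mul_add, abs_mul, abs_of_pos (by positivity : 0 < 2 * Real.pi)] at h1
  nlinarith

/-! ### Zero energy and slowly decaying potentials -/

theorem exists_nat_mul_rpow_lt {β s : ℝ} (h : β < s) (K : ℝ) :
    ∃ N : ℕ, 1 ≤ N ∧ K * (N : ℝ) ^ β < (N : ℝ) ^ s := by
  have ht : Filter.Tendsto (fun N : ℕ => (N : ℝ) ^ (s - β)) Filter.atTop Filter.atTop :=
    (tendsto_rpow_atTop (sub_pos.2 h)).comp tendsto_natCast_atTop_atTop
  obtain ⟨N, hN, hN1⟩ := ((ht.eventually_gt_atTop K).and (Filter.eventually_ge_atTop 1)).exists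
  refine ⟨N, hN1, ?_⟩
  have hpos : (0 : ℝ) < N := by exact_mod_cast hN1
  calc K * (N : ℝ) ^ β < (N : ℝ) ^ (s - β) * (N : ℝ) ^ β :=
        mul_lt_mul_of_pos_right hN (Real.rpow_pos_of_pos hpos _)
    _ = (N : ℝ) ^ s := by rw [← Real.rpow_add hpos]; congr 1; ring

theorem memℓp_top_of_abs_le_one {d : ℕ} {V : (Fin d → ℤ) → ℝ} (h : ∀ x, |V x| ≤ 1) :
    Memℓp V ∞ :=
  memℓp_infty ⟨1, by rintro _ ⟨x, rfl⟩; exact h x⟩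

theorem pow_le_card_cube (d N : ℕ) :
    (N : ℝ) ^ d ≤ ((Fintype.piFinset fun _ : Fin d => Finset.Icc (-(N : ℤ)) N).card : ℝ) := by
  rw [Fintype.card_piFinset]
  simp only [Int.card_Icc, Finset.prod_const, Finset.card_univ, Fintype.card_fin, Nat.cast_pow]
  refine pow_le_pow_left₀ (by positivity) ?_ d
  have : N ≤ ((N : ℤ) + 1 - -(N : ℤ)).toNat := by omega
  exact_mod_cast this

theorem not_birmanSchwingerBound_inverse_power {d : ℕ} {α : ℝ} (hd : 1 ≤ d) (h0 : 0 ≤ α)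
    (h2 : α < 2) : ¬ BirmanSchwingerBound d
      (fun x => (1 + Real.sqrt (∑ j, (x j : ℝ) ^ 2)) ^ (-α)) := by
  intro h
  have hV : ∀ x : Fin d → ℤ, |(1 + Real.sqrt (∑ j, (x j : ℝ) ^ 2)) ^ (-α)| ≤ 1 := by
    intro x
    have := Real.sqrt_nonneg (∑ j, (x j : ℝ) ^ 2)
    rw [abs_of_nonneg (by positivity)]
    exact Real.rpow_le_one_of_one_le_of_nonpos (by linarith) (by linarith)
  obtain ⟨C, hC⟩ := h.box_bound (memℓp_top_of_abs_le_one hV)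
  have hd' : (1 : ℝ) ≤ d := by exact_mod_cast hd
  -- Each of the `d` coordinates contributes at most `c` to the phase, in total `1/6`.
  set c : ℝ := 1 / (6 * d) with hc
  have hc0 : 0 < c := by positivity
  have hc6 : d * c = 1 / 6 := by rw [hc]; field_simp
  have hc1 : c ≤ 1 / 6 := by nlinarith
  set D : ℝ := (1 + d) ^ (-α) * (2 * c) ^ d with hD
  have hD0 : 0 < D := by positivity
  obtain ⟨N, hN, hlt⟩ := exists_nat_mul_rpow_lt h2 (C * (d * (40 * c ^ 2)) / D)
  have hN' : (1 : ℝ) ≤ N := by exact_mod_cast hN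
  have hcN : c / N ≤ 1 / 6 := (div_le_self hc0.le hN').trans hc1
  have hT : ∀ x ∈ Fintype.piFinset (fun _ : Fin d => Finset.Icc (-(N : ℤ)) N),
      ∀ j, |(x j : ℝ)| ≤ N := by
    intro x hx j
    have := Finset.mem_Icc.1 (Fintype.mem_piFinset.1 hx j)
    rw [abs_le]
    exact_mod_cast this
  have key := hC (Fintype.piFinset fun _ : Fin d => Finset.Icc (-(N : ℤ)) N)
    (((1 + d) * N) ^ (-α)) ⟨0, by simp⟩ (by positivity) ?_ 0
    {η | ∀ j, ‖η j‖ ≤ (fun _ => c / N) j} (measurableSet_torus_box _) 0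
    (d * (40 * (c / N) ^ 2)) (by positivity) ?_ ?_
  · rw [torusMeasure_real_box _ (fun _ => by positivity) (fun _ => by linarith)] at key
    simp only [Finset.prod_const, Finset.card_univ, Fintype.card_fin] at key
    have hcard := pow_le_card_cube d N
    have hA : ((1 + d : ℝ) * N) ^ (-α) = (1 + d : ℝ) ^ (-α) * (N : ℝ) ^ (-α) :=
      Real.mul_rpow (by positivity) (by positivity)
    have h5 : D * (N : ℝ) ^ (-α) ≤ C * (d * (40 * (c / N) ^ 2)) := by
      refine le_trans ?_ key
      calc D * (N : ℝ) ^ (-α)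
          = ((1 + d : ℝ) * N) ^ (-α) * (N : ℝ) ^ d * (2 * (c / N)) ^ d := by
            rw [hA, hD, mul_assoc _ ((N : ℝ) ^ d), ← mul_pow,
              show (N : ℝ) * (2 * (c / N)) = 2 * c by field_simp]
            ring
        _ ≤ _ := by gcongr
    have h6 : (N : ℝ) ^ (2 : ℝ) ≤ C * (d * (40 * c ^ 2)) / D * (N : ℝ) ^ α := by
      rw [Real.rpow_neg (by positivity)] at h5
      have hNα : 0 < (N : ℝ) ^ α := Real.rpow_pos_of_pos (by positivity) _
      rw [Real.rpow_two]
      rw [div_mul_eq_mul_div, le_div_iff₀ hD0]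
      have h7 := mul_le_mul_of_nonneg_right h5 (by positivity : 0 ≤ (N : ℝ) ^ α * (N : ℝ) ^ 2)
      calc (N : ℝ) ^ 2 * D = D * ((N : ℝ) ^ α)⁻¹ * ((N : ℝ) ^ α * (N : ℝ) ^ 2) := by
            field_simp
        _ ≤ _ := h7
        _ = _ := by field_simp
    linarith
  · intro x hx
    have hs : Real.sqrt (∑ j, (x j : ℝ) ^ 2) ≤ d * N := by
      rw [Real.sqrt_le_left (by positivity)]
      calc ∑ j, (x j : ℝ) ^ 2 ≤ d * N ^ 2 := by
            refine (Finset.sum_le_card_nsmul _ _ ((N : ℝ) ^ 2) fun j _ => ?_).trans (by simp)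
            rw [← sq_abs]
            exact pow_le_pow_left₀ (abs_nonneg _) (hT x hx j) 2
        _ ≤ _ := by nlinarith [sq_nonneg (N : ℝ)]
    rw [abs_of_nonneg (by positivity)]
    refine Real.rpow_le_rpow_of_nonpos (by positivity) ?_ (by linarith)
    linarith
  · intro η hη
    rw [zero_add, sub_zero, abs_of_nonneg (laplaceSymbol_nonneg d η)]
    exact laplaceSymbol_le η hη
  · intro η hη x hx
    refine (norm_sum_le _ _).trans ?_
    have h8 : ∀ j, ‖x j • η j‖ ≤ c := by
      intro j
      refine (norm_zsmul_le _ _).trans ?_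
      rw [Int.norm_eq_abs]
      calc _ ≤ (N : ℝ) * (c / N) := mul_le_mul (hT x hx j) (hη j) (norm_nonneg _) (by positivity)
        _ = c := by field_simp
    refine (Finset.sum_le_card_nsmul _ _ c fun j _ => h8 j).trans ?_
    simp only [Finset.card_univ, Fintype.card_fin, nsmul_eq_mul]
    exact hc6.le

/-! ### Knapp examples and weak spaces -/

/-- The potential `(1 + |x₀|^{1/3} + ∑_{j ≥ 1} |xⱼ - x₀|)^{-β}`, adapted to the cubic
degeneracy of the level set `h = 2d` at `(1/4, …, 1/4)`. -/
def knappPotential (k : ℕ) (β : ℝ) (x : Fin (k + 1) → ℤ) : ℝ :=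
  (1 + |(x 0 : ℝ)| ^ (1 / 3 : ℝ) + ∑ i : Fin k, |((x i.succ - x 0 : ℤ) : ℝ)|) ^ (-β)

theorem knappPotential_base_ge_one (k : ℕ) (x : Fin (k + 1) → ℤ) :
    1 ≤ 1 + |(x 0 : ℝ)| ^ (1 / 3 : ℝ) + ∑ i : Fin k, |((x i.succ - x 0 : ℤ) : ℝ)| := by
  have h1 : 0 ≤ |(x 0 : ℝ)| ^ (1 / 3 : ℝ) := by positivity
  have h2 : 0 ≤ ∑ i : Fin k, |((x i.succ - x 0 : ℤ) : ℝ)| :=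
    Finset.sum_nonneg fun _ _ => abs_nonneg _
  linarith

theorem knappPotential_nonneg (k : ℕ) (β : ℝ) (x : Fin (k + 1) → ℤ) :
    0 ≤ knappPotential k β x :=
  Real.rpow_nonneg (zero_le_one.trans (knappPotential_base_ge_one k x)) _

theorem abs_knappPotential_le_one (k : ℕ) {β : ℝ} (hβ : 0 ≤ β) (x : Fin (k + 1) → ℤ) :
    |knappPotential k β x| ≤ 1 := by
  rw [abs_of_nonneg (knappPotential_nonneg k β x)]
  exact Real.rpow_le_one_of_one_le_of_nonpos (knappPotential_base_ge_one k x) (by linarith)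

/-- The lattice points `x` with `|x₀| ≤ M` and `|xⱼ - x₀| ≤ L` for `j ≥ 1`. -/
def latticeShearBox (k M L : ℕ) : Finset (Fin (k + 1) → ℤ) :=
  (Fintype.piFinset (Fin.cons (Finset.Icc (-(M : ℤ)) M) fun _ => Finset.Icc (-(L : ℤ)) L :
    Fin (k + 1) → Finset ℤ)).image
      fun y => Fin.cons (y 0) fun i => y i.succ + y 0

theorem mem_latticeShearBox {k M L : ℕ} {x : Fin (k + 1) → ℤ} :
    x ∈ latticeShearBox k M L ↔ |x 0| ≤ M ∧ ∀ i : Fin k, |x i.succ - x 0| ≤ L := by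
  simp only [latticeShearBox, Finset.mem_image, Fintype.mem_piFinset, Fin.forall_fin_succ,
    Fin.cons_zero, Fin.cons_succ, Finset.mem_Icc, ← abs_le]
  constructor
  · rintro ⟨y, ⟨h0, hs⟩, rfl⟩
    simpa using ⟨h0, hs⟩
  · rintro ⟨h0, hs⟩
    refine ⟨Fin.cons (x 0) fun i => x i.succ - x 0, by simpa using ⟨h0, hs⟩, ?_⟩
    funext j
    refine Fin.cases ?_ (fun i => ?_) j <;> simp

theorem card_latticeShearBox (k M L : ℕ) :
    (latticeShearBox k M L).card = (2 * M + 1) * (2 * L + 1) ^ k := by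
  rw [latticeShearBox, Finset.card_image_of_injective, Fintype.card_piFinset, Fin.prod_univ_succ]
  · simp only [Fin.cons_zero, Fin.cons_succ, Int.card_Icc, Finset.prod_const, Finset.card_univ,
      Fintype.card_fin]
    congr 2 <;> omega
  · intro y y' h
    have h0 : y 0 = y' 0 := by simpa using congrFun h 0
    funext j
    refine Fin.cases h0 (fun i => ?_) j
    have := congrFun h i.succ
    simp only [Fin.cons_succ, h0] at this
    exact add_right_cancel this

theorem not_birmanSchwingerBound_knappPotential {k : ℕ} {β : ℝ} (hk : 1 ≤ k) (h0 : 0 ≤ β)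
    (h3 : β < 3) : ¬ BirmanSchwingerBound (k + 1) (knappPotential k β) := by
  intro h
  obtain ⟨C, hC⟩ := h.box_bound (memℓp_top_of_abs_le_one (abs_knappPotential_le_one k h0))
  have hk' : (1 : ℝ) ≤ k := by exact_mod_cast hk
  have hp := Real.pi_pos
  have hp4 := Real.pi_lt_four
  -- Small enough for three demands: the phase `(k+1)c` is at most `1/6`, the coordinates, of size
  -- at most `(k+1)c`, do not wrap around when summed, and `2π(k+1)c ≤ 1` for the sine expansion.
  set c : ℝ := 1 / (24 * (k + 1) ^ 2) with hc
  have hc0 : 0 < c := by positivity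
  have hck : (k + 1) * ((k + 1) * c) = 1 / 24 := by rw [hc]; field_simp
  have hkc : (k + 1) * c ≤ 1 / 24 := by
    have : 0 ≤ (k + 1) * c := by positivity
    nlinarith
  have hc1 : c ≤ 1 / 24 := by nlinarith
  -- With `ρ = c/N³` and `τ = (k+1)c/N` the linear and the cubic contributions to `h - 2d` both
  -- scale as `N^{-3}`; `B` collects their constants.
  set B : ℝ := 4 * Real.pi * c + 2 * ((k + 1 : ℕ) * (2 * Real.pi * ((k + 1) * c)) ^ 3) with hB
  have hB0 : 0 < B := by positivity
  set D : ℝ := (k + 2 : ℝ) ^ (-β) * (2 * c) ^ (k + 1) with hD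
  have hD0 : 0 < D := by positivity
  obtain ⟨N, hN, hlt⟩ := exists_nat_mul_rpow_lt h3 (C * B / D)
  have hN' : (1 : ℝ) ≤ N := by exact_mod_cast hN
  have hN3 : (N : ℝ) ≤ N ^ 3 := le_self_pow₀ hN' (by norm_num)
  have hσ : c / N ≤ c := div_le_self hc0.le hN'
  have hρσ : c / N ^ 3 ≤ c / N := div_le_div_of_nonneg_left hc0.le (by positivity) hN3
  have hT : ∀ x ∈ latticeShearBox k (N ^ 3) N, |(x 0 : ℝ)| ≤ (N : ℝ) ^ 3 ∧
      ∀ i : Fin k, |((x i.succ - x 0 : ℤ) : ℝ)| ≤ N := by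
    intro x hx
    rw [mem_latticeShearBox] at hx
    refine ⟨by exact_mod_cast hx.1, fun i => by exact_mod_cast hx.2 i⟩
  have key := hC (latticeShearBox k (N ^ 3) N) (((k + 2) * N) ^ (-β))
    ⟨0, by rw [mem_latticeShearBox]; simp⟩ (by positivity) ?_ (quarterPoint (k + 1))
    (shearBox k (c / N ^ 3) (c / N)) (measurableSet_shearBox _ _ _) (2 * (k + 1 : ℕ))
    (B / N ^ 3) (by positivity) ?_ ?_
  · rw [torusMeasure_real_shearBox k (by positivity) (by linarith) (by positivity)
      (by linarith), card_latticeShearBox] at key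
    have hcard : (N : ℝ) ^ 3 * (N : ℝ) ^ k ≤
        (((2 * N ^ 3 + 1) * (2 * N + 1) ^ k : ℕ) : ℝ) := by
      push_cast
      gcongr <;> nlinarith
    have hA : ((k + 2 : ℝ) * N) ^ (-β) = (k + 2 : ℝ) ^ (-β) * (N : ℝ) ^ (-β) :=
      Real.mul_rpow (by positivity) (by positivity)
    have h5 : D * (N : ℝ) ^ (-β) ≤ C * (B / N ^ 3) := by
      refine le_trans ?_ key
      calc D * (N : ℝ) ^ (-β)
          = ((k + 2 : ℝ) * N) ^ (-β) * ((N : ℝ) ^ 3 * (N : ℝ) ^ k) *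
              (2 * (c / N ^ 3) * (2 * (c / N)) ^ k) := by
            have h6 : (N : ℝ) ^ k * (2 * (c / N)) ^ k = (2 * c) ^ k := by
              rw [← mul_pow]; congr 1; field_simp
            have h7 : (N : ℝ) ^ 3 * (2 * (c / N ^ 3)) = 2 * c := by field_simp
            rw [hA, hD]
            calc _ = (k + 2 : ℝ) ^ (-β) * (N : ℝ) ^ (-β) * ((2 * c) * (2 * c) ^ k) := by ring
              _ = _ := by rw [← h6, ← h7]; ring
        _ ≤ _ := by gcongr
    have h6 : (N : ℝ) ^ (3 : ℝ) ≤ C * B / D * (N : ℝ) ^ β := by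
      rw [Real.rpow_neg (by positivity)] at h5
      have hNβ : 0 < (N : ℝ) ^ β := Real.rpow_pos_of_pos (by positivity) _
      rw [div_mul_eq_mul_div, le_div_iff₀ hD0]
      have h7 := mul_le_mul_of_nonneg_right h5 (by positivity : 0 ≤ (N : ℝ) ^ β * (N : ℝ) ^ 3)
      calc (N : ℝ) ^ (3 : ℝ) * D = D * ((N : ℝ) ^ β)⁻¹ * ((N : ℝ) ^ β * (N : ℝ) ^ 3) := by
            rw [show (3 : ℝ) = ((3 : ℕ) : ℝ) by norm_num, Real.rpow_natCast]
            field_simp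
        _ ≤ _ := h7
        _ = _ := by field_simp
    linarith
  · intro x hx
    rw [abs_of_nonneg (knappPotential_nonneg k β x)]
    obtain ⟨hx0, hxs⟩ := hT x hx
    refine Real.rpow_le_rpow_of_nonpos
      (zero_lt_one.trans_le (knappPotential_base_ge_one k x)) ?_ (by linarith)
    have e1 : |(x 0 : ℝ)| ^ (1 / 3 : ℝ) ≤ N := by
      calc _ ≤ ((N : ℝ) ^ 3) ^ (1 / 3 : ℝ) := Real.rpow_le_rpow (abs_nonneg _) hx0 (by norm_num)
        _ = N := by
          rw [← Real.rpow_natCast, ← Real.rpow_mul (by positivity)]; norm_num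
    have e2 : ∑ i : Fin k, |((x i.succ - x 0 : ℤ) : ℝ)| ≤ k * N := by
      refine (Finset.sum_le_card_nsmul _ _ (N : ℝ) fun i _ => hxs i).trans (by simp)
    linarith
  · intro η hη
    have hτ : ∀ j, ‖η j‖ ≤ (k + 1) * c / N := by
      intro j
      refine (norm_le_of_mem_shearBox (by positivity) (by positivity) hη hk j).trans ?_
      calc _ ≤ c / N + k * (c / N) := by gcongr
        _ = _ := by ring
    have hτ' : (k + 1) * c / N ≤ (k + 1) * c := div_le_self (by positivity) hN'
    refine (abs_laplaceSymbol_quarterPoint_sub_le η hη.1 hτ ?_ ?_).trans_eq ?_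
    · push_cast
      nlinarith
    · nlinarith
    · rw [hB]; field_simp
  · intro η hη x hx
    obtain ⟨hx0, hxs⟩ := hT x hx
    refine (norm_sum_zsmul_le_of_mem_shearBox hη x hx0 hxs (by positivity)).trans ?_
    calc _ = (k + 1) * c := by field_simp; ring
      _ ≤ _ := by linarith

/-- Inverting the power gives base `< R = α^{-1/β}`, hence a tube of length `R³` and width `R`. The
base is at least one, so nothing is left when `R < 1`; separating this case later permits `2⌊R⌋ + 1
≤ 3R`. -/
theorem knappPotential_superlevel_subset (k : ℕ) {β α : ℝ} (hβ : 0 < β) (hα : 0 < α) :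
    {x | α < |knappPotential k β x|} ⊆
      if 1 ≤ α ^ (-(1 / β)) then
        (latticeShearBox k ⌊(α ^ (-(1 / β))) ^ 3⌋₊ ⌊α ^ (-(1 / β))⌋₊ : Set (Fin (k + 1) → ℤ))
      else ∅ := by
  intro x hx
  set R := α ^ (-(1 / β)) with hR
  have hb := knappPotential_base_ge_one k x
  have hx' : α < knappPotential k β x := by
    simpa only [Set.mem_ofPred_eq, abs_of_nonneg (knappPotential_nonneg k β x)] using hx
  set X := 1 + |(x 0 : ℝ)| ^ (1 / 3 : ℝ) + ∑ i : Fin k, |((x i.succ - x 0 : ℤ) : ℝ)| with hX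
  have hXR : X < R := by
    have h := Real.rpow_lt_rpow_of_neg (z := -(1 / β)) hα hx' (by simpa using hβ)
    rwa [knappPotential, ← hX, ← Real.rpow_mul (by linarith), neg_mul_neg,
      mul_one_div_cancel hβ.ne', Real.rpow_one] at h
  have h1 : 1 ≤ R := hb.trans hXR.le
  rw [if_pos h1, Finset.mem_coe, mem_latticeShearBox]
  have e1 : 0 ≤ |(x 0 : ℝ)| ^ (1 / 3 : ℝ) := by positivity
  have e2 : ∀ i : Fin k, |((x i.succ - x 0 : ℤ) : ℝ)| ≤
      ∑ i : Fin k, |((x i.succ - x 0 : ℤ) : ℝ)| := fun i =>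
    Finset.single_le_sum (f := fun i : Fin k => |((x i.succ - x 0 : ℤ) : ℝ)|)
      (fun _ _ => abs_nonneg _) (Finset.mem_univ i)
  have e3 : 0 ≤ ∑ i : Fin k, |((x i.succ - x 0 : ℤ) : ℝ)| :=
    Finset.sum_nonneg fun _ _ => abs_nonneg _
  constructor
  · rw [← Int.natCast_natAbs, Int.ofNat_le]
    apply Nat.le_floor
    rw [Nat.cast_natAbs, Int.cast_abs]
    calc |(x 0 : ℝ)| = (|(x 0 : ℝ)| ^ (1 / 3 : ℝ)) ^ 3 := by
          rw [← Real.rpow_natCast, ← Real.rpow_mul (abs_nonneg _)]; norm_num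
      _ ≤ R ^ 3 := pow_le_pow_left₀ e1 (by linarith) 3
  · intro i
    rw [← Int.natCast_natAbs, Int.ofNat_le]
    apply Nat.le_floor
    rw [Nat.cast_natAbs, Int.cast_abs]
    linarith [e2 i]

theorem encard_knappPotential_superlevel_le (k : ℕ) {β α : ℝ} (hβ : 0 < β) (hα : 0 < α) :
    ((Set.encard {x | α < |knappPotential k β x|} : ℕ∞) : ℝ≥0∞) ≤
      ENNReal.ofReal (3 ^ (k + 1) * (α ^ (-(1 / β))) ^ (k + 3)) := by
  have h := Set.encard_le_encard (knappPotential_superlevel_subset k hβ hα)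
  refine (ENat.toENNReal_le.2 h).trans ?_
  split_ifs with h1
  · set R := α ^ (-(1 / β))
    rw [Set.encard_coe_eq_coe_finsetCard, ENat.toENNReal_coe, card_latticeShearBox,
      ← ENNReal.ofReal_natCast]
    apply ENNReal.ofReal_le_ofReal
    have f1 : (⌊R⌋₊ : ℝ) ≤ R := Nat.floor_le (by linarith)
    have f2 : (⌊R ^ 3⌋₊ : ℝ) ≤ R ^ 3 := Nat.floor_le (by positivity)
    have f3 : 1 ≤ R ^ 3 := one_le_pow₀ h1
    push_cast
    calc _ ≤ (3 * R ^ 3) * (3 * R) ^ k := by gcongr <;> linarith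
      _ = _ := by ring
  · simp

/-- The superlevel sets have at most a constant times `R^{k+3}` points, and `R^{k+3} = α^{-q}` for
the exponent `β = (k+3)/q`. -/
theorem memWeak_knappPotential (k : ℕ) {q : ℝ≥0∞} (hq0 : q ≠ 0) (hq : q ≠ ∞) :
    MemWeak (k + 1) q (knappPotential k ((k + 3) / q.toReal)) := by
  have hqr : 0 < q.toReal := ENNReal.toReal_pos hq0 hq
  have hβ : 0 < ((k : ℝ) + 3) / q.toReal := by positivity
  rw [MemWeak, weakNorm, if_neg hq]
  refine lt_of_le_of_lt (iSup_le fun α => ?_)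
    (ENNReal.ofReal_lt_top (r := (3 ^ (k + 1)) ^ (1 / q.toReal)))
  obtain ⟨α, hα⟩ := α
  calc _ ≤ ENNReal.ofReal α * (ENNReal.ofReal (3 ^ (k + 1) *
        (α ^ (-(1 / ((k + 3) / q.toReal)))) ^ (k + 3))) ^ (1 / q.toReal) := by
        gcongr
        exact encard_knappPotential_superlevel_le k hβ hα
    _ = _ := by
        rw [ENNReal.ofReal_rpow_of_nonneg (by positivity) (by positivity),
          ← ENNReal.ofReal_mul hα.le]
        congr 1
        rw [Real.mul_rpow (by positivity) (by positivity), ← Real.rpow_natCast (α ^ _),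
          ← Real.rpow_mul hα.le, ← Real.rpow_mul hα.le]
        have : -(1 / (((k : ℝ) + 3) / q.toReal)) * ((k + 3 : ℕ) : ℝ) * (1 / q.toReal) = -1 := by
          push_cast; field_simp
        rw [this, Real.rpow_neg_one]
        field_simp

theorem exists_memWeak_not_birmanSchwingerBound {d : ℕ} {q : ℝ≥0∞} (hd : 3 ≤ d)
    (hq : ((d : ℝ≥0∞) + 2) / 3 < q) :
    ∃ V : (Fin d → ℤ) → ℝ, MemWeak d q V ∧ ¬ BirmanSchwingerBound d V := by
  obtain ⟨k, rfl⟩ : ∃ k, d = k + 1 := ⟨d - 1, by omega⟩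
  by_cases hqt : q = ∞
  -- For `q = ∞` decay is not needed: exponent zero gives the constant potential `1`.
  · refine ⟨knappPotential k 0, ?_,
      not_birmanSchwingerBound_knappPotential (by omega) le_rfl (by norm_num)⟩
    rw [MemWeak, weakNorm, if_pos hqt]
    refine lt_of_le_of_lt (iSup_le fun x => ?_) ENNReal.one_lt_top
    exact ENNReal.ofReal_le_one.2 (abs_knappPotential_le_one k le_rfl x)
  · have hq0 : q ≠ 0 := ((zero_le).trans_lt hq).ne'
    have hqr : 0 < q.toReal := ENNReal.toReal_pos hq0 hqt
    refine ⟨_, memWeak_knappPotential k hq0 hqt,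
      not_birmanSchwingerBound_knappPotential (by omega) (by positivity) ?_⟩
    have h := ENNReal.toReal_strict_mono hqt hq
    rw [ENNReal.toReal_div, ENNReal.toReal_add (by simp) (by simp)] at h
    push_cast at h
    simp only [ENNReal.toReal_add (ENNReal.natCast_ne_top k) ENNReal.one_ne_top,
      ENNReal.toReal_natCast, ENNReal.toReal_one, ENNReal.toReal_ofNat] at h
    rw [div_lt_iff₀ hqr]
    linarith

theorem exists_memWeak_half_not_birmanSchwingerBound {d : ℕ} (hd : 5 ≤ d) :
    ∃ V : (Fin d → ℤ) → ℝ, MemWeak d ((d : ℝ≥0∞) / 2) V ∧ ¬ BirmanSchwingerBound d V := by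
  refine exists_memWeak_not_birmanSchwingerBound (by omega) ?_
  have hd' : (5 : ℝ) ≤ d := by exact_mod_cast hd
  have h : ((d : ℝ) + 2) / 3 < (d : ℝ) / 2 := by linarith
  have h1 : ((d : ℝ≥0∞) + 2) / 3 = ENNReal.ofReal (((d : ℝ) + 2) / 3) := by
    rw [ENNReal.ofReal_div_of_pos (by norm_num), ENNReal.ofReal_add (by positivity) (by norm_num)]
    simp
  have h2 : (d : ℝ≥0∞) / 2 = ENNReal.ofReal ((d : ℝ) / 2) := by
    rw [ENNReal.ofReal_div_of_pos (by norm_num)]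
    simp
  rw [h1, h2]
  exact (ENNReal.ofReal_lt_ofReal_iff (by linarith)).2 h

/-! ### The flat level set in dimension two -/

/-- The diagonal points `(m, m)`, `1 ≤ m ≤ N`, of `ℤ²`. -/
def diagonalPoints (N : ℕ) : Finset (Fin 2 → ℤ) :=
  (Finset.Icc 1 N).image fun (m : ℕ) _ => (m : ℤ)

theorem sum_diagonalPoints {M : Type*} [AddCommMonoid M] (N : ℕ) (f : (Fin 2 → ℤ) → M) :
    ∑ x ∈ diagonalPoints N, f x = ∑ m ∈ Finset.Icc 1 N, f fun _ => (m : ℤ) := by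
  rw [diagonalPoints, Finset.sum_image]
  intro m _ m' _ h
  have h0 : (m : ℤ) = m' := congrFun h 0
  exact_mod_cast h0

theorem quarterPoint_mem_quarterPoints (d : ℕ) : quarterPoint d ∈ quarterPoints d :=
  fun _ => Or.inl rfl

/-- The slab has measure `4s²/N` and the energy width is `4πs/N`, so their ratio, and with it `c`,
does not depend on `N`. -/
theorem exists_diagonal_lower_bound {χ : C(UnitAddTorus (Fin 2), ℝ)} (hχ : ∀ ξ, 0 ≤ χ ξ)
    (h1 : ∀ᶠ ξ in nhdsSet (quarterPoints 2), χ ξ = 1) :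
    ∃ c : ℝ, 0 < c ∧ ∀ (N : ℕ) (a : (Fin 2 → ℤ) → ℝ), 1 ≤ N →
      (∀ x ∈ diagonalPoints N, 0 ≤ a x) → ∃ z : ℂ, z.im ≠ 0 ∧
      c * (∑ x ∈ diagonalPoints N, a x) ^ 2 ≤
        ‖inner ℂ (finsuppVec (diagonalPoints N) (modulate a (quarterPoint 2)))
          ((fourierMultiplier 2 (complexSymbol 2 χ) ∘L freeResolvent 2 z)
            (finsuppVec (diagonalPoints N) (modulate a (quarterPoint 2))))‖ := by
  have hev := (nhds_le_nhdsSet (quarterPoint_mem_quarterPoints 2)) h1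
  obtain ⟨r, hr, hball⟩ := Metric.eventually_nhds_iff.1 hev
  -- The slab has coordinates at most `2s`: this is below `r`, so that `χ = 1`, and at most `1/4`,
  -- as the level-set estimate requires. On the diagonal the phase is at most `s < 1/6`.
  set s : ℝ := min (r / 4) (1 / 8) with hs
  have hs0 : 0 < s := by positivity
  have hs8 : s ≤ 1 / 8 := min_le_right _ _
  have hsr : s ≤ r / 4 := min_le_left _ _
  have hp := Real.pi_pos
  refine ⟨s / (8 * Real.pi), by positivity, fun N a hN ha => ?_⟩
  have hN' : (1 : ℝ) ≤ N := by exact_mod_cast hN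
  have hρ : s / N ≤ s := div_le_self hs0.le hN'
  have hτ : ∀ η ∈ shearBox 1 (s / N) s, ∀ j, ‖η j‖ ≤ 2 * s := by
    intro η hη j
    refine (norm_le_of_mem_shearBox (by positivity) hs0.le hη le_rfl j).trans ?_
    push_cast
    linarith
  have hball' : ∀ η ∈ shearBox 1 (s / N) s, χ (quarterPoint 2 + η) = 1 := by
    intro η hη
    apply hball
    rw [dist_eq_norm, add_sub_cancel_left]
    refine lt_of_le_of_lt ((pi_norm_le_iff_of_nonneg (by positivity)).2 (hτ η hη)) ?_
    linarith
  have hlevel : ∀ η ∈ shearBox 1 (s / N) s,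
      |laplaceSymbol 2 (quarterPoint 2 + η) - 4| ≤ 4 * Real.pi * (s / N) := fun η hη =>
    abs_laplaceSymbol_quarterPoint_sub_le_two η hη.1 (hτ η hη) (by linarith)
  have hphase : ∀ η ∈ shearBox 1 (s / N) s, ∀ x ∈ diagonalPoints N,
      ‖∑ j, x j • η j‖ ≤ 1 / 6 := by
    intro η hη x hx
    obtain ⟨m, hm, rfl⟩ := Finset.mem_image.1 hx
    have hm2 : (m : ℝ) ≤ N := by exact_mod_cast (Finset.mem_Icc.1 hm).2
    refine (norm_sum_zsmul_le_of_mem_shearBox hη _ (M := N) (L := 0) ?_ ?_ le_rfl).trans ?_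
    · simpa using hm2
    · intro i; simp
    · have : (N : ℝ) * (s / N) = s := by field_simp
      rw [this]; norm_num; linarith
  obtain ⟨z, hz, hle⟩ := exists_le_norm_inner_resolvent χ hχ (diagonalPoints N) a ha
    (quarterPoint 2) (shearBox 1 (s / N) s) (measurableSet_shearBox _ _ _) 4
    (4 * Real.pi * (s / N)) (by positivity) hball' hlevel hphase
  refine ⟨z, hz, le_trans (le_of_eq ?_) hle⟩
  rw [torusMeasure_real_shearBox 1 (by positivity) (by linarith) hs0.le (by linarith)]
  field_simp
  norm_num

/-- The weight equal to `m^{-1/2}` at `(m, m)`, `m ≥ 1`, and to zero elsewhere. -/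
def diagonalWeight (x : Fin 2 → ℤ) : ℝ :=
  if x 1 = x 0 ∧ 1 ≤ x 0 then (Real.sqrt (x 0))⁻¹ else 0

theorem diagonalWeight_diagonal {m : ℕ} (hm : 1 ≤ m) :
    diagonalWeight (fun _ => (m : ℤ)) = (Real.sqrt m)⁻¹ := by
  rw [diagonalWeight, if_pos ⟨rfl, by exact_mod_cast hm⟩]
  simp

theorem abs_diagonalWeight_le_one (x : Fin 2 → ℤ) : |diagonalWeight x| ≤ 1 := by
  rw [diagonalWeight]
  split_ifs with h
  · rw [abs_of_nonneg (by positivity)]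
    apply inv_le_one_of_one_le₀
    rw [Real.one_le_sqrt]
    exact_mod_cast h.2
  · simp

theorem memWeak_diagonalWeight : MemWeak 2 2 diagonalWeight := by
  rw [MemWeak, weakNorm, if_neg (by simp)]
  refine lt_of_le_of_lt (iSup_le fun α => ?_) ENNReal.one_lt_top
  obtain ⟨α, hα⟩ := α
  have hsub : {x | α < |diagonalWeight x|} ⊆ (diagonalPoints ⌊(α ^ 2)⁻¹⌋₊ : Set (Fin 2 → ℤ)) := by
    intro x hx
    rw [Set.mem_ofPred_eq, diagonalWeight] at hx
    split_ifs at hx with h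
    · obtain ⟨m, hm⟩ := Int.eq_ofNat_of_zero_le (by omega : 0 ≤ x 0)
      have hm1 : 1 ≤ m := by have := h.2; omega
      have hx' : (fun _ => (m : ℤ)) = x := by
        funext j
        fin_cases j
        · exact hm.symm
        · exact (h.1.trans hm).symm
      rw [Finset.mem_coe, diagonalPoints, Finset.mem_image]
      refine ⟨m, Finset.mem_Icc.2 ⟨hm1, Nat.le_floor ?_⟩, hx'⟩
      rw [abs_of_nonneg (by positivity), hm] at hx
      have hm0 : (0 : ℝ) < m := by exact_mod_cast hm1
      have h2 := pow_lt_pow_left₀ hx hα.le two_ne_zero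
      rw [inv_pow] at h2
      push_cast at h2
      rw [Real.sq_sqrt hm0.le] at h2
      rw [le_inv_comm₀ hm0 (by positivity)]
      exact h2.le
    · rw [abs_zero] at hx
      exact absurd hx (not_lt.2 hα.le)
  have hcard : (diagonalPoints ⌊(α ^ 2)⁻¹⌋₊).card ≤ ⌊(α ^ 2)⁻¹⌋₊ :=
    Finset.card_image_le.trans (by simp)
  have henc : ((Set.encard {x | α < |diagonalWeight x|} : ℕ∞) : ℝ≥0∞) ≤
      ENNReal.ofReal (α ^ 2)⁻¹ := by
    refine (ENat.toENNReal_le.2 (Set.encard_le_encard hsub)).trans ?_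
    rw [Set.encard_coe_eq_coe_finsetCard, ENat.toENNReal_coe, ← ENNReal.ofReal_natCast]
    apply ENNReal.ofReal_le_ofReal
    exact (Nat.cast_le.2 hcard).trans (Nat.floor_le (by positivity))
  calc _ ≤ ENNReal.ofReal α * (ENNReal.ofReal (α ^ 2)⁻¹) ^ (1 / (2 : ℝ≥0∞).toReal) := by
        gcongr
    _ = ENNReal.ofReal (α * ((α ^ 2)⁻¹) ^ (1 / (2 : ℝ≥0∞).toReal)) := by
        rw [ENNReal.ofReal_rpow_of_nonneg (by positivity) (by positivity),
          ← ENNReal.ofReal_mul hα.le]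
    _ = 1 := by
        rw [ENNReal.toReal_ofNat, ← Real.sqrt_eq_rpow, Real.sqrt_inv, Real.sqrt_sq hα.le,
          mul_inv_cancel₀ hα.ne', ENNReal.ofReal_one]

theorem exists_harmonic_gt (K : ℝ) : ∃ N : ℕ, 1 ≤ N ∧ K < ∑ m ∈ Finset.Icc 1 N, 1 / (m : ℝ) := by
  have h := Real.tendsto_sum_range_one_div_nat_succ_atTop
  obtain ⟨N, hN, hN1⟩ := ((h.eventually_gt_atTop K).and (Filter.eventually_ge_atTop 1)).exists
  refine ⟨N, hN1, hN.trans_le (le_of_eq ?_)⟩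
  clear hN hN1 h
  induction N with
  | zero => simp
  | succ n ih => rw [Finset.sum_range_succ, Finset.sum_Icc_succ_top (by omega), ih]; push_cast; rfl

/-- With amplitudes `1/m` both `∑ a` and `∑ a²/w²` equal the harmonic sum `H`, so a uniform bound
`C` would give `c H² ≤ C H`. -/
theorem not_bddAbove_diagonalWeight {χ : C(UnitAddTorus (Fin 2), ℝ)} (hχ : ∀ ξ, 0 ≤ χ ξ)
    (h1 : ∀ᶠ ξ in nhdsSet (quarterPoints 2), χ ξ = 1) :
    ¬ BddAbove (Set.range fun z : {z : ℂ // z.im ≠ 0} =>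
      ‖latticeMul 2 (fun x => (diagonalWeight x : ℂ)) ∘L
        fourierMultiplier 2 (complexSymbol 2 χ) ∘L freeResolvent 2 z ∘L
          latticeMul 2 (fun x => (diagonalWeight x : ℂ))‖) := by
  rintro ⟨C, hC⟩
  obtain ⟨c, hc, hlow⟩ := exists_diagonal_lower_bound hχ h1
  obtain ⟨N, hN, hgt⟩ := exists_harmonic_gt (max (C / c) 1)
  have hw : Memℓp (fun x => (diagonalWeight x : ℂ)) ∞ := by
    refine memℓp_infty ⟨1, ?_⟩
    rintro _ ⟨x, rfl⟩
    simpa using abs_diagonalWeight_le_one x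
  have ha : ∀ x ∈ diagonalPoints N, 0 ≤ 1 / (x 0 : ℝ) := by
    intro x hx
    obtain ⟨m, hm, rfl⟩ := Finset.mem_image.1 hx
    simp
  obtain ⟨z, hz, hle⟩ := hlow N (fun x => 1 / (x 0 : ℝ)) hN ha
  have hw0 : ∀ x ∈ diagonalPoints N, diagonalWeight x ≠ 0 := by
    intro x hx
    obtain ⟨m, hm, rfl⟩ := Finset.mem_image.1 hx
    have hm1 := (Finset.mem_Icc.1 hm).1
    rw [diagonalWeight_diagonal hm1]
    have : (0 : ℝ) < m := by exact_mod_cast hm1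
    positivity
  have hup := norm_inner_le_of_norm_weighted_le hw
    (fourierMultiplier 2 (complexSymbol 2 χ) ∘L freeResolvent 2 z) (hC ⟨⟨z, hz⟩, rfl⟩)
    (diagonalPoints N) hw0 (modulate (fun x => 1 / (x 0 : ℝ)) (quarterPoint 2))
  have hle2 := hle.trans hup
  rw [sum_diagonalPoints, sum_diagonalPoints] at hle2
  have hsum : ∑ m ∈ Finset.Icc 1 N, ‖modulate (fun x : Fin 2 → ℤ => 1 / (x 0 : ℝ))
      (quarterPoint 2) (fun _ => (m : ℤ))‖ ^ 2 / diagonalWeight (fun _ => (m : ℤ)) ^ 2 =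
      ∑ m ∈ Finset.Icc 1 N, 1 / (m : ℝ) := by
    refine Finset.sum_congr rfl fun m hm => ?_
    have hm1 := (Finset.mem_Icc.1 hm).1
    have hm0 : (0 : ℝ) < m := by exact_mod_cast hm1
    rw [diagonalWeight_diagonal hm1, norm_modulate, inv_pow, Real.sq_sqrt hm0.le, sq_abs]
    push_cast
    field_simp
  rw [hsum] at hle2
  simp only [Int.cast_natCast] at hle2
  set H := ∑ m ∈ Finset.Icc 1 N, 1 / (m : ℝ)
  have hH : 0 < H := zero_lt_one.trans ((le_max_right _ _).trans_lt hgt)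
  have h2 : C / c < H := (le_max_left _ _).trans_lt hgt
  rw [div_lt_iff₀ hc] at h2
  nlinarith

/-- The triangle inequality bounds the `l^p` norm of the test vector by `N` for every `p`. Hölder on
the `N` diagonal points then gives `c N² ≤ |C| N^{2 - 1/q}`, which fails for large `N` as `q` is
finite. -/
theorem not_uniformlyBoundedLp_of_diagonal_lower_bound
    {T : ℂ → l2Lattice 2 →L[ℂ] l2Lattice 2} {c : ℝ} (hc : 0 < c)
    (hlow : ∀ N : ℕ, 1 ≤ N → ∃ z : ℂ, z.im ≠ 0 ∧ ∃ b : (Fin 2 → ℤ) → ℂ, (∀ x, ‖b x‖ = 1) ∧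
      c * (N : ℝ) ^ 2 ≤ ‖inner ℂ (finsuppVec (diagonalPoints N) b)
        (T z (finsuppVec (diagonalPoints N) b))‖)
    {p q : ℝ≥0∞} (hp : 1 ≤ p) (hq : 1 ≤ q) (hqt : q ≠ ∞) : ¬ UniformlyBoundedLp 2 p q T := by
  rintro ⟨C, hC⟩
  have : Fact (1 ≤ p) := ⟨hp⟩
  have : Fact (1 ≤ q) := ⟨hq⟩
  set r := q.toReal with hr
  have hr1 : 1 ≤ r := by
    have := ENNReal.toReal_mono hqt hq
    simpa using this
  have hr0 : 0 < r := by linarith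
  obtain ⟨N, hN⟩ := exists_nat_gt (max ((|C| / c) ^ r) 1)
  have hN1 : (1 : ℝ) < N := (le_max_right _ _).trans_lt hN
  have hN2 : (|C| / c) ^ r < N := (le_max_left _ _).trans_lt hN
  obtain ⟨z, hz, b, hb, hle⟩ := hlow N (by exact_mod_cast hN1.le)
  set v := finsuppVec (diagonalPoints N) b
  have hcard : ((diagonalPoints N).card : ℝ) ≤ N := by
    have : (diagonalPoints N).card ≤ N := Finset.card_image_le.trans (by simp)
    exact_mod_cast this
  have hcoe : ((∑ x ∈ diagonalPoints N, lp.single p x (b x) :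
      lp (fun _ : Fin 2 → ℤ => ℂ) p) : (Fin 2 → ℤ) → ℂ) = fun x => v x := by
    funext x
    simp only [v, finsuppVec, lp.coeFn_sum, Finset.sum_apply, lp.coeFn_single]
  have hu : Memℓp (fun x => v x) p := hcoe ▸ lp.memℓp _
  obtain ⟨hv, hbound⟩ := hC z hz v hu
  have hun : ‖(⟨fun x => v x, hu⟩ : lp (fun _ : Fin 2 → ℤ => ℂ) p)‖ ≤ N := by
    have : (⟨fun x => v x, hu⟩ : lp (fun _ : Fin 2 → ℤ => ℂ) p) =
        ∑ x ∈ diagonalPoints N, lp.single p x (b x) := Subtype.ext hcoe.symm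
    rw [this]
    refine (norm_sum_le _ _).trans ?_
    simp only [lp.norm_single (zero_lt_one.trans_le hp), hb]
    simpa using hcard
  set g : lp (fun _ : Fin 2 → ℤ => ℂ) q := ⟨fun x => T z v x, hv⟩
  have hg : ‖g‖ ≤ |C| * N := by
    refine hbound.trans ?_
    calc _ ≤ |C| * ‖(⟨fun x => v x, hu⟩ : lp (fun _ : Fin 2 → ℤ => ℂ) p)‖ := by
          gcongr; exact le_abs_self C
      _ ≤ _ := by gcongr
  have hsum : ‖inner ℂ v (T z v)‖ ≤ ∑ x ∈ diagonalPoints N, ‖g x‖ := by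
    rw [inner_finsuppVec]
    refine (norm_sum_le _ _).trans (Finset.sum_le_sum fun x _ => ?_)
    rw [norm_mul, RCLike.norm_conj, hb, one_mul]
  have hpow : (c * (N : ℝ) ^ 2) ^ r ≤ (N : ℝ) ^ (r - 1) * (|C| * N) ^ r := by
    calc (c * (N : ℝ) ^ 2) ^ r ≤ (∑ x ∈ diagonalPoints N, ‖g x‖) ^ r := by
          gcongr; exact hle.trans hsum
      _ ≤ ((diagonalPoints N).card : ℝ) ^ (r - 1) * ∑ x ∈ diagonalPoints N, ‖g x‖ ^ r :=
          Real.rpow_sum_le_const_mul_sum_rpow_of_nonneg _ hr1 fun _ _ => norm_nonneg _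
      _ ≤ (N : ℝ) ^ (r - 1) * ‖g‖ ^ r := by
          gcongr
          exact lp.sum_rpow_le_norm_rpow hr0 g _
      _ ≤ _ := by
          have hg0 := norm_nonneg g
          gcongr
  have hN0 : (0 : ℝ) < N := by linarith
  have e1 : (c * (N : ℝ) ^ 2) ^ r = c ^ r * ((N : ℝ) ^ r * (N : ℝ) ^ r) := by
    rw [Real.mul_rpow hc.le (by positivity), sq, Real.mul_rpow hN0.le hN0.le]
  rw [e1, Real.mul_rpow (abs_nonneg C) hN0.le, Real.rpow_sub_one hN0.ne'] at hpow
  rw [Real.div_rpow (abs_nonneg C) hc.le, div_lt_iff₀ (by positivity)] at hN2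
  have hNr : 0 < (N : ℝ) ^ r := by positivity
  have h3 : (N : ℝ) * c ^ r * ((N : ℝ) ^ r * (N : ℝ) ^ r) ≤
      |C| ^ r * ((N : ℝ) ^ r * (N : ℝ) ^ r) := by
    calc _ = N * (c ^ r * ((N : ℝ) ^ r * (N : ℝ) ^ r)) := by ring
      _ ≤ N * ((N : ℝ) ^ r / N * (|C| ^ r * (N : ℝ) ^ r)) := by gcongr
      _ = _ := by field_simp
  have h4 := le_of_mul_le_mul_right h3 (by positivity)
  linarith

theorem not_uniformlyBoundedLp_fourierMultiplier {χ : C(UnitAddTorus (Fin 2), ℝ)}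
    (hχ : ∀ ξ, 0 ≤ χ ξ) (h1 : ∀ᶠ ξ in nhdsSet (quarterPoints 2), χ ξ = 1)
    {p q : ℝ≥0∞} (hp : 1 ≤ p) (hq : 1 ≤ q) (hqt : q ≠ ∞) :
    ¬ UniformlyBoundedLp 2 p q
      (fun z => fourierMultiplier 2 (complexSymbol 2 χ) ∘L freeResolvent 2 z) := by
  obtain ⟨c, hc, hlow⟩ := exists_diagonal_lower_bound hχ h1
  refine not_uniformlyBoundedLp_of_diagonal_lower_bound hc (fun N hN => ?_) hp hq hqt
  obtain ⟨z, hz, hle⟩ := hlow N (fun _ => 1) hN (fun _ _ => zero_le_one)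
  refine ⟨z, hz, _, fun x => ?_, le_trans (le_of_eq ?_) hle⟩
  · rw [norm_modulate, abs_one]
  · rw [sum_diagonalPoints]; simp

/-! ### Negative spectrum and compact perturbations -/

/-- Otherwise the self-adjoint `A` has non-negative spectrum and is therefore a positive operator.
-/
theorem exists_neg_mem_spectrum_of_inner_neg {E : Type*} [NormedAddCommGroup E]
    [InnerProductSpace ℂ E] [CompleteSpace E] {A : E →L[ℂ] E} (hA : IsSelfAdjoint A) {φ : E}
    (hφ : (inner ℂ φ (A φ)).re < 0) : ∃ e : ℝ, e < 0 ∧ (e : ℂ) ∈ spectrum ℂ A := by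
  by_contra! h
  have h0 : 0 ≤ A := by
    rw [StarOrderedRing.nonneg_iff_spectrum_nonneg (R := ℝ) A hA]
    intro e he
    by_contra! hneg
    exact h e hneg (spectrum.algebraMap_mem ℂ he)
  have h1 := ((ContinuousLinearMap.nonneg_iff_isPositive A).1 h0).re_inner_nonneg_right φ
  exact absurd h1 (not_le.2 hφ)

/-- A compact perturbation `A + W` of `A` has every point of its spectrum outside that of `A`
as an eigenvalue. -/
theorem hasEigenvalue_add_of_isCompactOperator {E : Type*} [NormedAddCommGroup E]
    [NormedSpace ℂ E] [CompleteSpace E] {A W R : E →L[ℂ] E} {e : ℂ}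
    (hR : R * (A - e • 1) = 1) (hR' : (A - e • 1) * R = 1) (hW : IsCompactOperator W)
    (he : e ∈ spectrum ℂ (A + W)) : Module.End.HasEigenvalue ((A + W : E →L[ℂ] E) : E →ₗ[ℂ] E) e := by
  have hK : IsCompactOperator (R * W : E →L[ℂ] E) := hW.clm_comp R
  -- Since `A + W - e = (A - e)(1 + RW)` with `A - e` invertible, `1 + RW` is not invertible. A
  -- nonzero spectral value of a compact operator is an eigenvalue.
  have hmem : (-1 : ℂ) ∈ spectrum ℂ (R * W : E →L[ℂ] E) := by
    rw [spectrum.mem_iff] at he ⊢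
    intro hu
    apply he
    have hfac : algebraMap ℂ (E →L[ℂ] E) e - (A + W) =
        (A - e • 1) * (algebraMap ℂ (E →L[ℂ] E) (-1) - R * W) := by
      rw [mul_sub, ← mul_assoc, hR', one_mul, Algebra.algebraMap_eq_smul_one,
        Algebra.algebraMap_eq_smul_one, neg_smul, one_smul, mul_neg, mul_one]
      abel
    rw [hfac]
    exact IsUnit.mul ⟨⟨A - e • 1, R, hR', hR⟩, rfl⟩ hu
  rw [← hK.hasEigenvalue_iff_mem_spectrum (by norm_num)] at hmem
  obtain ⟨u, hu⟩ := hmem.exists_hasEigenvector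
  have h1 : R (W u) = -u := by
    have := hu.apply_eq_smul
    simpa using this
  have h2 : (A - e • 1) (R (W u)) = W u := by
    have := congrArg (fun T : E →L[ℂ] E => T (W u)) hR'
    exact this
  rw [h1] at h2
  refine Module.End.hasEigenvalue_of_hasEigenvector (x := u)
    ⟨Module.End.mem_eigenspace_iff.2 ?_, hu.2⟩
  change A u + W u = e • u
  rw [← h2]
  simp

theorem norm_latticeMul_le {d : ℕ} {f : (Fin d → ℤ) → ℂ} {K : ℝ} (hK : 0 ≤ K)
    (h : ∀ x, ‖f x‖ ≤ K) : ‖latticeMul d f‖ ≤ K := by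
  have hf : Memℓp f ∞ := memℓp_infty ⟨K, by rintro _ ⟨x, rfl⟩; exact h x⟩
  refine ContinuousLinearMap.opNorm_le_bound _ hK fun u => ?_
  have h1 : ‖latticeMul d f u‖ ≤ ‖(K : ℂ) • u‖ := by
    refine lp.norm_mono (by norm_num) fun x => ?_
    rw [latticeMul_apply d f hf, lp.coeFn_smul, Pi.smul_apply, norm_mul, norm_smul,
      Complex.norm_real, Real.norm_eq_abs, abs_of_nonneg hK]
    exact mul_le_mul_of_nonneg_right (h x) (norm_nonneg _)
  rwa [norm_smul, Complex.norm_real, Real.norm_eq_abs, abs_of_nonneg hK] at h1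

/-- Multiplication by the restriction of `f` to a finite set, as a finite rank operator. -/
def finiteRankMul {d : ℕ} (s : Finset (Fin d → ℤ)) (f : (Fin d → ℤ) → ℂ) :
    l2Lattice d →L[ℂ] l2Lattice d :=
  ∑ x ∈ s, lp.singleContinuousLinearMap ℂ (fun _ : Fin d → ℤ => ℂ) 2 x ∘L
    (f x • lp.evalCLM ℂ (fun _ : Fin d → ℤ => ℂ) 2 x)

theorem finiteRankMul_apply {d : ℕ} (s : Finset (Fin d → ℤ)) (f : (Fin d → ℤ) → ℂ)
    (u : l2Lattice d) : finiteRankMul s f u = finsuppVec s fun x => f x * u x := by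
  rw [finiteRankMul, _root_.sum_apply, finsuppVec]
  rfl

theorem isCompactOperator_finiteRankMul {d : ℕ} (s : Finset (Fin d → ℤ))
    (f : (Fin d → ℤ) → ℂ) : IsCompactOperator (finiteRankMul s f) := by
  classical
  rw [finiteRankMul]
  induction s using Finset.induction_on with
  | empty => exact isCompactOperator_zero
  | insert x s hx ih =>
    rw [Finset.sum_insert hx]
    have h : IsCompactOperator (f x • lp.evalCLM ℂ (fun _ : Fin d → ℤ => ℂ) 2 x) :=
      isCompactOperator_of_locallyCompactSpace_dom
        (f x • lp.evalCLM ℂ (fun _ : Fin d → ℤ => ℂ) 2 x)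
    exact (h.clm_comp (lp.singleContinuousLinearMap ℂ (fun _ : Fin d → ℤ => ℂ) 2 x)).add ih

/-- Truncations to finite sets have finite rank and converge in norm, the error being the supremum
of `|f|` off the set. -/
theorem isCompactOperator_latticeMul {d : ℕ} {f : (Fin d → ℤ) → ℂ} (hf : Memℓp f ∞)
    (h0 : Filter.Tendsto f Filter.cofinite (nhds 0)) : IsCompactOperator (latticeMul d f) := by
  classical
  refine isCompactOperator_of_tendsto (l := Filter.atTop) (F := fun s => finiteRankMul s f) ?_
    (Filter.Eventually.of_forall fun s => isCompactOperator_finiteRankMul s f)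
  rw [Metric.tendsto_atTop]
  intro ε hε
  have hfin : {x | ¬ ‖f x‖ < ε / 2}.Finite := by
    have := Metric.tendsto_nhds.1 h0 (ε / 2) (by positivity)
    simpa only [dist_zero_right, Filter.eventually_cofinite] using this
  refine ⟨hfin.toFinset, fun s hs => ?_⟩
  have hg : ∀ x, ‖(if x ∈ s then 0 else f x : ℂ)‖ ≤ ε / 2 := by
    intro x
    split_ifs with hx
    · simp; positivity
    · by_contra hlt
      exact hx (hs (hfin.mem_toFinset.2 fun h => hlt h.le))
  have hgm : Memℓp (fun x => if x ∈ s then 0 else f x : (Fin d → ℤ) → ℂ) ∞ :=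
    memℓp_infty ⟨ε / 2, by rintro _ ⟨x, rfl⟩; exact hg x⟩
  have heq : latticeMul d f - finiteRankMul s f =
      latticeMul d (fun x => if x ∈ s then 0 else f x) := by
    ext1 u
    ext x
    rw [_root_.sub_apply, lp.coeFn_sub, Pi.sub_apply, latticeMul_apply d f hf,
      latticeMul_apply d _ hgm, finiteRankMul_apply, finsuppVec_apply]
    split_ifs <;> simp
  rw [dist_comm, dist_eq_norm, heq]
  exact (norm_latticeMul_le (by positivity) hg).trans_lt (by linarith)

theorem isSelfAdjoint_latticeMul_ofReal {d : ℕ} {w : (Fin d → ℤ) → ℝ}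
    (hw : Memℓp (fun x => (w x : ℂ)) ∞) :
    IsSelfAdjoint (latticeMul d fun x => (w x : ℂ)) := by
  rw [ContinuousLinearMap.isSelfAdjoint_iff_isSymmetric]
  exact fun u v => inner_latticeMul_ofReal hw u v

/-! ### Dimensions one and two -/

/-- In dimensions one and two the Green function at the origin diverges at zero energy. -/
theorem exists_integral_inv_laplaceSymbol_ge {d : ℕ} (hd : d = 1 ∨ d = 2) (n : ℕ) :
    (n : ℝ) / 28 ≤
      ∫ ξ, (laplaceSymbol d ξ + (1 / 4 : ℝ) ^ n)⁻¹ ∂(torusMeasure d) := by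
  classical
  have hd2 : (d : ℝ) ≤ 2 := by rcases hd with rfl | rfl <;> norm_num
  set B : ℕ → Set (UnitAddTorus (Fin d)) := fun k => {η | ∀ j, ‖η j‖ ≤ (1 / 2 : ℝ) ^ (k + 1)}
  have hB : ∀ k, MeasurableSet (B k) := fun k => measurableSet_torus_box fun _ => (1 / 2) ^ (k + 1)
  have hBm : ∀ k, 1 ≤ (4 : ℝ) ^ k * (torusMeasure d).real (B k) := by
    intro k
    have h := torusMeasure_real_box (d := d) (fun _ => (1 / 2 : ℝ) ^ (k + 1))
      (fun _ => by positivity) (fun _ => by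
        rw [pow_succ]
        have := pow_le_one₀ (n := k) (by norm_num : (0 : ℝ) ≤ 1 / 2) (by norm_num)
        linarith)
    have h2 : (2 : ℝ) * (1 / 2) ^ (k + 1) = (1 / 2) ^ k := by rw [pow_succ]; ring
    simp only [Finset.prod_const, Finset.card_univ, Fintype.card_fin, h2] at h
    change 1 ≤ (4 : ℝ) ^ k * (torusMeasure d).real {η | ∀ j, ‖η j‖ ≤ (1 / 2 : ℝ) ^ (k + 1)}
    rw [h]
    have h3 : (4 : ℝ) ^ k * ((1 / 2) ^ k) ^ 2 = 1 := by
      rw [← pow_mul, mul_comm k 2, pow_mul, ← mul_pow]; norm_num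
    rcases hd with rfl | rfl
    · rw [pow_one, ← mul_pow]
      exact one_le_pow₀ (by norm_num)
    · exact h3.ge
  -- A dyadic minorant of `28/(h + 4^{-m})`: each of its `m` layers has integral at least one,
  -- because the box `B k` has measure at least `4^{-k}` when `d ≤ 2`. In the induction, outside `B
  -- m` the new layer vanishes and the shift decreases; inside, the geometric sum is at most
  -- `4^{m+1}/3` and `h + 4^{-(m+1)} ≤ 21 · 4^{-m}`, with product `28`.
  have hpt : ∀ (m : ℕ) (ξ : UnitAddTorus (Fin d)),
      (∑ k ∈ Finset.range m, (B k).indicator (fun _ => (4 : ℝ) ^ k) ξ) *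
        (laplaceSymbol d ξ + (1 / 4 : ℝ) ^ m) ≤ 28 := by
    intro m ξ
    induction m with
    | zero => simp
    | succ m ih =>
      have hh := laplaceSymbol_nonneg d ξ
      have hpow : (1 / 4 : ℝ) ^ (m + 1) = (1 / 4) ^ m / 4 := by rw [pow_succ]; ring
      have hpos : (0 : ℝ) < (1 / 4 : ℝ) ^ m := by positivity
      have hnn : ∀ k, 0 ≤ (B k).indicator (fun _ => (4 : ℝ) ^ k) ξ := fun k =>
        Set.indicator_nonneg (fun _ _ => by positivity) ξ
      have hsnn := Finset.sum_nonneg fun k (_ : k ∈ Finset.range m) => hnn k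
      by_cases hξ : ξ ∈ B m
      · have hle : ∀ M : ℕ, ∑ k ∈ Finset.range M, (B k).indicator (fun _ => (4 : ℝ) ^ k) ξ ≤
            4 ^ M / 3 := by
          intro M
          induction M with
          | zero => simp
          | succ M ihM =>
            rw [Finset.sum_range_succ, pow_succ]
            have : (B M).indicator (fun _ => (4 : ℝ) ^ M) ξ ≤ 4 ^ M :=
              Set.indicator_le_self' (fun _ _ => by positivity) ξ
            linarith
        have h1 := laplaceSymbol_le ξ hξ
        have h2 : ((1 / 2 : ℝ) ^ (m + 1)) ^ 2 = (1 / 4) ^ m / 4 := by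
          rw [← pow_mul, mul_comm, pow_mul, pow_succ]; norm_num; ring
        rw [h2] at h1
        have h3 : laplaceSymbol d ξ + (1 / 4 : ℝ) ^ (m + 1) ≤ 21 * (1 / 4) ^ m := by
          rw [hpow]
          nlinarith
        calc _ ≤ (4 ^ (m + 1) / 3) * (21 * (1 / 4 : ℝ) ^ m) := by
              refine mul_le_mul (hle _) h3 (by positivity) (by positivity)
          _ = 28 * ((4 : ℝ) ^ m * (1 / 4) ^ m) := by rw [pow_succ]; ring
          _ = 28 := by rw [← mul_pow]; norm_num
      · rw [Finset.sum_range_succ, Set.indicator_of_notMem hξ, add_zero, hpow]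
        refine le_trans ?_ ih
        gcongr
        linarith
  have hpos : ∀ ξ : UnitAddTorus (Fin d), 0 < laplaceSymbol d ξ + (1 / 4 : ℝ) ^ n := fun ξ =>
    add_pos_of_nonneg_of_pos (laplaceSymbol_nonneg d ξ) (by positivity)
  have hint : ∀ k, Integrable ((B k).indicator fun _ => (4 : ℝ) ^ k) (torusMeasure d) := fun k =>
    (integrable_const _).indicator (hB k)
  have hcont : Continuous fun ξ : UnitAddTorus (Fin d) =>
      (laplaceSymbol d ξ + (1 / 4 : ℝ) ^ n)⁻¹ :=
    Continuous.inv₀ ((laplaceSymbol d).continuous.add continuous_const) fun ξ => (hpos ξ).ne'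
  calc (n : ℝ) / 28 = (∑ k ∈ Finset.range n, (1 : ℝ)) / 28 := by simp
    _ ≤ (∑ k ∈ Finset.range n, ∫ ξ, (B k).indicator (fun _ => (4 : ℝ) ^ k) ξ
          ∂(torusMeasure d)) / 28 := by
        gcongr with k _
        rw [integral_indicator (hB k), setIntegral_const, smul_eq_mul, mul_comm]
        exact hBm k
    _ = ∫ ξ, (∑ k ∈ Finset.range n, (B k).indicator (fun _ => (4 : ℝ) ^ k) ξ) / 28
          ∂(torusMeasure d) := by
        rw [integral_div, integral_finsetSum _ fun k _ => hint k]
    _ ≤ _ := by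
        refine integral_mono ((integrable_finsetSum _ fun k _ => hint k).div_const 28)
          (integrable_torus_of_continuous hcont) fun ξ => ?_
        change _ / _ ≤ (laplaceSymbol d ξ + (1 / 4 : ℝ) ^ n)⁻¹
        rw [div_le_iff₀ (by norm_num), inv_mul_eq_div, le_div_iff₀ (hpos ξ)]
        exact hpt n ξ

theorem trigPoly_singleton_norm {d : ℕ} (x : Fin d → ℤ) (ξ : UnitAddTorus (Fin d)) :
    ‖trigPoly {x} (fun _ => 1) ξ‖ = 1 := by
  simp [trigPoly, norm_mFourier_apply]

/-- The spectral parameter must be non-real. Imaginary part `ε` at `-ε` costs only a factor two, as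
`ε ≤ h + ε`. -/
theorem resolventSymbol_re_ge {d : ℕ} {ε : ℝ} (hε : 0 < ε)
    (hz : ∀ ξ, (laplaceSymbol d ξ : ℂ) - (⟨-ε, ε⟩ : ℂ) ≠ 0) (ξ : UnitAddTorus (Fin d)) :
    (laplaceSymbol d ξ + ε)⁻¹ / 2 ≤ (resolventSymbol d ⟨-ε, ε⟩ hz ξ).re := by
  change _ ≤ (((laplaceSymbol d ξ : ℂ) - (⟨-ε, ε⟩ : ℂ))⁻¹).re
  have h : ((laplaceSymbol d ξ : ℂ) - (⟨-ε, ε⟩ : ℂ)) = ⟨laplaceSymbol d ξ + ε, -ε⟩ := by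
    apply Complex.ext <;> simp
  have hh := laplaceSymbol_nonneg d ξ
  rw [h, Complex.inv_re, Complex.normSq_mk, ← one_div, div_div,
    div_le_div_iff₀ (by positivity) (by nlinarith)]
  nlinarith

theorem not_birmanSchwingerBound_low_dimension {d : ℕ} (hd : d = 1 ∨ d = 2)
    {V : (Fin d → ℤ) → ℝ} (hV : Memℓp V ∞) {x₀ : Fin d → ℤ} (hx : V x₀ ≠ 0) :
    ¬ BirmanSchwingerBound d V := by
  intro h
  obtain ⟨C, hC0, hC⟩ := h.exists_norm_inner_le hV
  -- The Green function is at least `n/28`, and the real part of the form at least half of that.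
  obtain ⟨n, hn⟩ := exists_nat_gt (56 * (C * (1 / |V x₀|)))
  set ε : ℝ := (1 / 4 : ℝ) ^ n with hεdef
  have hε : 0 < ε := by positivity
  have hz : (⟨-ε, ε⟩ : ℂ).im ≠ 0 := hε.ne'
  have h1 := hC ⟨-ε, ε⟩ hz {x₀} (by simpa using hx) (fun _ => 1)
  rw [freeResolvent_eq d hz, inner_fourierMultiplier_finsuppVec] at h1
  simp only [trigPoly_singleton_norm, one_pow, Complex.ofReal_one, mul_one,
    Finset.sum_singleton, norm_one] at h1
  set m := resolventSymbol d ⟨-ε, ε⟩ (laplaceSymbol_sub_ne_zero d hz)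
  have hint : Integrable (fun ξ => m ξ) (torusMeasure d) :=
    integrable_torus_of_continuous m.continuous
  have hre : (∫ ξ, m ξ ∂(torusMeasure d)).re = ∫ ξ, (m ξ).re ∂(torusMeasure d) := by
    have := integral_re hint
    simpa only [RCLike.re_to_complex] using this.symm
  have hpos : ∀ ξ : UnitAddTorus (Fin d), 0 < laplaceSymbol d ξ + ε := fun ξ =>
    add_pos_of_nonneg_of_pos (laplaceSymbol_nonneg d ξ) hε
  have hcont : Continuous fun ξ : UnitAddTorus (Fin d) => (laplaceSymbol d ξ + ε)⁻¹ :=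
    Continuous.inv₀ ((laplaceSymbol d).continuous.add continuous_const) fun ξ => (hpos ξ).ne'
  have h2 : (∫ ξ, (laplaceSymbol d ξ + ε)⁻¹ ∂(torusMeasure d)) / 2 ≤
      (∫ ξ, m ξ ∂(torusMeasure d)).re := by
    rw [hre, ← integral_div]
    refine integral_mono ((integrable_torus_of_continuous hcont).div_const 2) hint.re fun ξ => ?_
    exact resolventSymbol_re_ge hε _ ξ
  have h3 := exists_integral_inv_laplaceSymbol_ge hd n
  rw [← hεdef] at h3
  have h4 := (Complex.re_le_norm (∫ ξ, m ξ ∂(torusMeasure d))).trans h1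
  linarith

theorem re_inner_latticeMul_le {d : ℕ} {V : (Fin d → ℤ) → ℝ} (hV : Memℓp V ∞)
    (hneg : ∀ x, V x ≤ 0) (x₀ : Fin d → ℤ) (φ : l2Lattice d) :
    (inner ℂ φ (latticeMul d (fun x => (V x : ℂ)) φ)).re ≤ V x₀ * ‖φ x₀‖ ^ 2 := by
  have hVc : Memℓp (fun x => (V x : ℂ)) ∞ := by
    obtain ⟨K, hK⟩ := memℓp_infty_iff.1 hV
    refine memℓp_infty ⟨K, ?_⟩
    rintro _ ⟨x, rfl⟩
    simpa using hK ⟨x, rfl⟩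
  have hs := sqrt_abs_memℓp hV
  set Q := latticeMul d (fun x => (Real.sqrt |V x| : ℂ)) with hQ
  have hfac : latticeMul d (fun x => (V x : ℂ)) φ = -(Q (Q φ)) := by
    ext x
    rw [lp.coeFn_neg, Pi.neg_apply, latticeMul_apply d _ hVc, hQ, latticeMul_apply d _ hs,
      latticeMul_apply d _ hs, ← mul_assoc, ← Complex.ofReal_mul,
      Real.mul_self_sqrt (abs_nonneg _), abs_of_nonpos (hneg x)]
    simp
  rw [hfac, inner_neg_right, ← inner_latticeMul_ofReal hs, Complex.neg_re]
  have h1 : (inner ℂ (Q φ) (Q φ)).re = ‖Q φ‖ ^ 2 := by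
    have := inner_self_eq_norm_sq (𝕜 := ℂ) (Q φ)
    simpa using this
  have h2 : ‖Q φ x₀‖ ≤ ‖Q φ‖ := lp.norm_apply_le_norm (by norm_num) _ _
  have h3 := pow_le_pow_left₀ (norm_nonneg _) h2 2
  rw [hQ, latticeMul_apply d _ hs, norm_mul, mul_pow, Complex.norm_real, Real.norm_eq_abs,
    abs_of_nonneg (Real.sqrt_nonneg _), Real.sq_sqrt (abs_nonneg _), abs_of_nonpos (hneg x₀),
    ← hQ] at h3
  rw [h1]
  linarith

theorem laplaceSymbol_sub_neg_ne_zero (d : ℕ) {e : ℝ} (he : e < 0) (ξ : UnitAddTorus (Fin d)) :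
    (laplaceSymbol d ξ : ℂ) - (e : ℂ) ≠ 0 := by
  have h := laplaceSymbol_nonneg d ξ
  rw [← Complex.ofReal_sub]
  exact_mod_cast (by linarith : 0 < laplaceSymbol d ξ - e).ne'

/-- For `φ = (H₀ + ε)⁻¹ δ` at `x₀`, with `G = φ(x₀)`, the kinetic energy is at most `⟨φ, δ⟩ = G`,
while the potential contributes at most `λ V(x₀) G²`. The quadratic term wins once `G > 1/(λ
|V(x₀)|)`. -/
theorem exists_inner_neg {d : ℕ} (hd : d = 1 ∨ d = 2) {V : (Fin d → ℤ) → ℝ} (hV : Memℓp V ∞)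
    (hneg : ∀ x, V x ≤ 0) {x₀ : Fin d → ℤ} (hx : V x₀ ≠ 0) {lam : ℝ} (hlam : 0 < lam) :
    ∃ φ : l2Lattice d, (inner ℂ φ ((negLaplacian d +
      (lam : ℂ) • latticeMul d (fun x => (V x : ℂ))) φ)).re < 0 := by
  have hV0 : V x₀ < 0 := lt_of_le_of_ne (hneg x₀) hx
  obtain ⟨n, hn⟩ := exists_nat_gt (28 * (1 / (lam * (-V x₀))))
  set ε : ℝ := (1 / 4 : ℝ) ^ n with hεdef
  have hε : 0 < ε := by positivity
  set G := ∫ ξ, (laplaceSymbol d ξ + ε)⁻¹ ∂(torusMeasure d) with hG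
  have hGn : (n : ℝ) / 28 ≤ G := exists_integral_inv_laplaceSymbol_ge hd n
  have hGl : 1 / (lam * (-V x₀)) < G := by linarith
  have hlV : 0 < lam * (-V x₀) := mul_pos hlam (by linarith)
  rw [div_lt_iff₀ hlV] at hGl
  have hG0 : 0 < G := by
    by_contra! hle
    nlinarith
  have hz := laplaceSymbol_sub_neg_ne_zero d (neg_lt_zero.2 hε)
  set δ := finsuppVec {x₀} (fun _ => (1 : ℂ)) with hδ
  set φ := fourierMultiplier d (resolventSymbol d ((-ε : ℝ) : ℂ) hz) δ with hφ
  have hin : inner ℂ δ φ = (G : ℂ) := by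
    rw [hφ, hδ, inner_fourierMultiplier_finsuppVec]
    simp only [trigPoly_singleton_norm, one_pow, Complex.ofReal_one, mul_one]
    rw [hG, ← integral_complex_ofReal]
    refine integral_congr_ae (Filter.Eventually.of_forall fun ξ => ?_)
    change ((laplaceSymbol d ξ : ℂ) - ((-ε : ℝ) : ℂ))⁻¹ = _
    push_cast
    rw [sub_neg_eq_add]
  have hφx : φ x₀ = (G : ℂ) := by
    rw [← hin, hδ, inner_finsuppVec]
    simp
  have hres : negLaplacian d φ = δ - (ε : ℂ) • φ := by
    have h := congrArg (fun T : l2Lattice d →L[ℂ] l2Lattice d => T δ)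
      (negLaplacian_sub_mul_resolvent d ((-ε : ℝ) : ℂ) hz)
    have h' : negLaplacian d φ - ((-ε : ℝ) : ℂ) • φ = δ := h
    rw [← h']
    push_cast
    rw [neg_smul]
    abel
  refine ⟨φ, ?_⟩
  have hpot := re_inner_latticeMul_le hV hneg x₀ φ
  rw [hφx, Complex.norm_real, Real.norm_eq_abs, sq_abs] at hpot
  have hkin : (inner ℂ φ (negLaplacian d φ)).re ≤ G := by
    rw [hres, inner_sub_right, inner_smul_right, ← inner_conj_symm, hin, Complex.conj_ofReal,
      Complex.sub_re, Complex.ofReal_re, Complex.re_ofReal_mul]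
    have : 0 ≤ (inner ℂ φ φ).re := inner_self_nonneg (𝕜 := ℂ) (x := φ)
    nlinarith
  rw [_root_.add_apply, _root_.smul_apply, inner_add_right,
    inner_smul_right, Complex.add_re, Complex.re_ofReal_mul]
  have h1 : lam * (inner ℂ φ (latticeMul d (fun x => (V x : ℂ)) φ)).re ≤ lam * (V x₀ * G ^ 2) :=
    mul_le_mul_of_nonneg_left hpot hlam.le
  nlinarith

theorem exists_eigenvalue_low_dimension {d : ℕ} (hd : d = 1 ∨ d = 2) {V : (Fin d → ℤ) → ℝ}
    (hV : Memℓp V ∞) (hneg : ∀ x, V x ≤ 0) (hne : ∃ x, V x ≠ 0)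
    (hlim : Filter.Tendsto V Filter.cofinite (nhds 0)) {lam : ℝ} (hlam : 0 < lam) :
    ∃ E : ℝ, Module.End.HasEigenvalue
      ((negLaplacian d + (lam : ℂ) • latticeMul d (fun x => (V x : ℂ)) :
        l2Lattice d →L[ℂ] l2Lattice d) : l2Lattice d →ₗ[ℂ] l2Lattice d) (E : ℂ) := by
  obtain ⟨x₀, hx⟩ := hne
  have hVc : Memℓp (fun x => (V x : ℂ)) ∞ := by
    obtain ⟨K, hK⟩ := memℓp_infty_iff.1 hV
    refine memℓp_infty ⟨K, ?_⟩
    rintro _ ⟨x, rfl⟩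
    simpa using hK ⟨x, rfl⟩
  obtain ⟨φ, hφ⟩ := exists_inner_neg hd hV hneg hx hlam
  have hsa : IsSelfAdjoint (negLaplacian d + (lam : ℂ) • latticeMul d (fun x => (V x : ℂ))) := by
    refine (isSelfAdjoint_negLaplacian d).add (IsSelfAdjoint.smul ?_
      (isSelfAdjoint_latticeMul_ofReal hVc))
    exact Complex.conj_ofReal lam
  obtain ⟨e, he, hspec⟩ := exists_neg_mem_spectrum_of_inner_neg hsa hφ
  have hz := laplaceSymbol_sub_neg_ne_zero d he
  have hlim' : Filter.Tendsto (fun x => (V x : ℂ)) Filter.cofinite (nhds 0) := by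
    have := (Complex.continuous_ofReal.tendsto 0).comp hlim
    simpa [Function.comp_def] using this
  exact ⟨e, hasEigenvalue_add_of_isCompactOperator (resolvent_mul_negLaplacian_sub d e hz)
    (negLaplacian_sub_mul_resolvent d e hz)
    ((isCompactOperator_latticeMul hVc hlim').smul (lam : ℂ)) hspec⟩

end

theorem theorem1p6 :
    -- (i)
    (∀ (d : ℕ) (V : (Fin d → ℤ) → ℝ), d = 1 ∨ d = 2 →
      Memℓp V ⊤ → (∀ x, V x ≤ 0) → (∃ x, V x ≠ 0) →
      Filter.Tendsto V Filter.cofinite (nhds 0) →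
        ¬ BirmanSchwingerBound d V ∧
        ∀ lam : ℝ, 0 < lam → ∃ E : ℝ,
          Module.End.HasEigenvalue
            ((negLaplacian d + (lam : ℂ) • latticeMul d (fun x => (V x : ℂ)) :
              l2Lattice d →L[ℂ] l2Lattice d) : l2Lattice d →ₗ[ℂ] l2Lattice d) (E : ℂ)) ∧
    -- (ii)
    (∀ χ : C(UnitAddTorus (Fin 2), ℝ), TorusSmooth 2 χ → (∀ ξ, 0 ≤ χ ξ) →
      (∀ᶠ ξ in nhdsSet (quarterPoints 2), χ ξ = 1) →
        (∃ w : (Fin 2 → ℤ) → ℝ, MemWeak 2 2 w ∧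
          ¬ BddAbove (Set.range fun z : {z : ℂ // z.im ≠ 0} =>
            ‖latticeMul 2 (fun x => (w x : ℂ)) ∘L fourierMultiplier 2 (complexSymbol 2 χ) ∘L
              freeResolvent 2 z ∘L latticeMul 2 (fun x => (w x : ℂ))‖)) ∧
        ∀ p q : ENNReal, 1 ≤ p → 1 ≤ q → q ≠ ⊤ →
          ¬ UniformlyBoundedLp 2 p q
            (fun z => fourierMultiplier 2 (complexSymbol 2 χ) ∘L freeResolvent 2 z)) ∧
    -- (iii)
    (∀ (d : ℕ) (q : ENNReal), 3 ≤ d → ((d : ENNReal) + 2) / 3 < q →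
      ∃ V : (Fin d → ℤ) → ℝ, MemWeak d q V ∧ ¬ BirmanSchwingerBound d V) ∧
    (∀ d : ℕ, 5 ≤ d →
      ∃ V : (Fin d → ℤ) → ℝ, MemWeak d ((d : ENNReal) / 2) V ∧ ¬ BirmanSchwingerBound d V) ∧
    -- (iv)
    (∀ (d : ℕ) (α : ℝ), 3 ≤ d → 0 ≤ α → α < 2 →
      ¬ BirmanSchwingerBound d
        (fun x => (1 + Real.sqrt (∑ j, (x j : ℝ) ^ 2)) ^ (-α))) := by
  refine ⟨?_, ?_, ?_, ?_, ?_⟩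
  · intro d V hd hV hneg hne hlim
    obtain ⟨x₀, hx⟩ := id hne
    exact ⟨not_birmanSchwingerBound_low_dimension hd hV hx,
      fun lam hlam => exists_eigenvalue_low_dimension hd hV hneg hne hlim hlam⟩
  · intro χ _ hχ h1
    exact ⟨⟨diagonalWeight, memWeak_diagonalWeight, not_bddAbove_diagonalWeight hχ h1⟩,
      fun p q hp hq hqt => not_uniformlyBoundedLp_fourierMultiplier hχ h1 hp hq hqt⟩
  · exact fun d q hd hq => exists_memWeak_not_birmanSchwingerBound hd hq
  · exact fun d hd => exists_memWeak_half_not_birmanSchwingerBound hd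
  · exact fun d α hd h0 h2 => not_birmanSchwingerBound_inverse_power (by omega) h0 h2
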